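/- For a compact set $K\subset\mathbb C$ let $\mathcal P(K)$ be the set of Borel probability measures on $K$. For $\mu\in\mathcal P(K)$ put $U^\mu(z)=\int\log\frac1{|z-t|}\,d\mu(t)$ and $I(\mu)=\int U^\mu\,d\mu$. Let $V_K=\inf_{\mu\in\mathcal P(K)}I(\mu)\in(-\infty,+\infty]$ and $\operatorname{cap}(K)=e^{-V_K}$ (so $\operatorname{cap}(\emptyset)=0$). Let $\Omega_K$ be the unbounded connected component of $\mathbb C\setminus K$ and let $\partial\Omega_K\subset\mathbb C$ be its boundary. When $\operatorname{cap}(K)>0$, let $\mu_K$ be the equilibrium measure (the unique $\mu\in\mathcal P(K)$ with $I(\mu)=V_K$). Then $\Omega_K$ is called regular if $U^{\mu_K}(z)\to V_K$ as $z\to\zeta$, $z\in\Omega_K$, for every $\zeta\in\partial\Omega_K$. The Green's function $g_K(\cdot,\infty):\Omega_K\to\mathbb R$ is the unique harmonic function on $\Omega_K$ which is bounded outside every neighbourhood of $\infty$, is such that $g_K(z,\infty)-\log|z|$ is bounded near $\infty$, and tends to $0$ at all points of $\partial\Omega_K$ outside a Borel set of capacity zero (a Borel set all of whose compact subsets have capacity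 zero). **Theorem.** Let $K_1,K_2\subset\mathbb C$ be non-empty compact sets and let $f:\Omega_{K_1}\cup\{\infty\}\to\Omega_{K_2}\cup\{\infty\}$ be a non-constant holomorphic map (between open subsets of the Riemann sphere) with $f(\infty)=\infty$. Then $f(z)\sim A_fz^{n_f}$ as $z\to\infty$ for some complex number $A_f\neq0$ and integer $n_f\ge1$, and (a) $|A_f|\operatorname{cap}(K_1)^{n_f}\ge\operatorname{cap}(K_2)$. (b) Assume moreover that (i) $\operatorname{cap}(K_2)>0$; (ii) $f^{-1}(\infty)=\{\infty\}$; (iii) $\Omega_{K_2}$ is regular; (iv) $f$ extends continuously to $\partial\Omega_{K_1}$, the extension mapping $\partial\Omega_{K_1}$ into $\partial\Omega_{K_2}$. Then $\operatorname{cap}(K_1)>0$, $\Omega_{K_1}$ is regular, $g_{K_1}(z,\infty)=\frac1{n_f}\,g_{K_2}(f(z),\infty)$ for all $z\in\Omega_{K_1}$, and $|A_f|\operatorname{cap}(K_1)^{n_f}=\operatorname{cap}(K_2)$. **Corollary.** Let $f(z)=\sum_{i=0}^na_iz^i$ be a complex polynomial of degree $n\ge1$ ($a_n\ne0$) and let $K\subset\mathbb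 C$ be compact. Then $|a_n|\operatorname{cap}(f^{-1}(K))^n=\operatorname{cap}(K)$. -/

import Mathlib

open Filter Topology MeasureTheory
open scoped OnePoint

noncomputable section

/-! ### Potentials, energy, capacity -/

/-- Integral of an `EReal`-valued function: integral of the positive part minus integral of the
negative part. (Below, the negative part always has a finite integral.) -/
def erealIntegral (μ : Measure ℂ) (u : ℂ → EReal) : EReal :=
  ((∫⁻ z, (u z).toENNReal ∂μ : ENNReal) : EReal) - ((∫⁻ z, (-(u z)).toENNReal ∂μ : ENNReal) : EReal)

/-- The logarithmic kernel `log (1 / |z - t|)`, equal to `+∞` when `z = t`. -/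
def logKernel (z t : ℂ) : EReal := -ENNReal.log (edist z t)

/-- The potential `U^μ(z) = ∫ log (1 / |z - t|) dμ(t)`. -/
def logPotential (μ : Measure ℂ) (z : ℂ) : EReal := erealIntegral μ (logKernel z)

/-- The energy `I(μ) = ∫ U^μ dμ`. -/
def logEnergy (μ : Measure ℂ) : EReal := erealIntegral μ (logPotential μ)

/-- The Borel probability measures carried by `K`, seen as measures on `ℂ`. -/
def probMeasuresOn (K : Set ℂ) : Set (Measure ℂ) := {μ | IsProbabilityMeasure μ ∧ μ Kᶜ = 0}

/-- The Robin constant `V_K`, the infimum of the energies of the probability measures on `K`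
(it is `+∞` when `K` is empty). -/
def robinConstant (K : Set ℂ) : EReal := ⨅ μ ∈ probMeasuresOn K, logEnergy μ

/-- The logarithmic capacity `exp (-V_K)` of a compact set `K`. As `V_K > -∞` for compact `K`,
it is a finite number. -/
def logCapacity (K : Set ℂ) : ℝ := (EReal.exp (-robinConstant K)).toReal

/-- `μ` is an equilibrium measure of `K`. -/
def IsEquilibriumMeasure (K : Set ℂ) (μ : Measure ℂ) : Prop :=
  μ ∈ probMeasuresOn K ∧ logEnergy μ = robinConstant K

/-- The equilibrium measure `μ_K`: it exists if `K` is compact and non-empty, and is unique if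
moreover `K` has positive capacity. -/
def equilibriumMeasure (K : Set ℂ) : Measure ℂ := Classical.epsilon (IsEquilibriumMeasure K)

/-- `Ω_K`: the unbounded connected component of `ℂ \ K` (unique for compact `K`). -/
def outerDomain (K : Set ℂ) : Set ℂ :=
  {z | z ∉ K ∧ ¬ Bornology.IsBounded (connectedComponentIn Kᶜ z)}

/-- `Ω_K` is a regular set: the equilibrium potential of `K` tends to `V_K` at every boundary
point of `Ω_K`. -/
def IsRegularOuterDomain (K : Set ℂ) : Prop :=
  ∀ ζ ∈ frontier (outerDomain K),
    Tendsto (logPotential (equilibriumMeasure K)) (𝓝[outerDomain K] ζ) (𝓝 (robinConstant K))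

/-- A property holds quasi-almost everywhere in `E`: it holds outside a Borel set of capacity zero,
the capacity of a Borel set being the supremum of the capacities of its compact subsets. -/
def QuasiAlmostEverywhere (E : Set ℂ) (P : ℂ → Prop) : Prop :=
  ∃ S : Set ℂ, MeasurableSet S ∧ (∀ C ⊆ S, IsCompact C → logCapacity C = 0) ∧ ∀ ζ ∈ E \ S, P ζ

/-- `g` is a Green's function of `Ω_K` with pole at infinity. Only the values of `g` on `Ω_K`
matter. -/
structure IsGreenFunction (K : Set ℂ) (g : ℂ → ℝ) : Prop where
  harmonic : InnerProductSpace.HarmonicOnNhd g (outerDomain K)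
  bounded : ∀ R : ℝ, ∃ M : ℝ, ∀ z ∈ outerDomain K, ‖z‖ ≤ R → |g z| ≤ M
  atInfinity : (fun z => g z - Real.log ‖z‖) =O[Bornology.cobounded ℂ] (fun _ => (1 : ℝ))
  boundary : QuasiAlmostEverywhere (frontier (outerDomain K))
    (fun ζ => Tendsto g (𝓝[outerDomain K] ζ) (𝓝 0))

/-- The Green's function `g_K(·, ∞)`: it exists, and is uniquely determined on `Ω_K`, if `K` is
compact of positive capacity. -/
def greenFunction (K : Set ℂ) : ℂ → ℝ := Classical.epsilon (IsGreenFunction K)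

/-! ### Holomorphic maps between open subsets of the Riemann sphere `OnePoint ℂ` -/

/-- The affine coordinate `z` (with value `0` at `∞`). -/
def affineCoord (q : OnePoint ℂ) : ℂ := q.elim 0 id

/-- The local coordinate used at the point `p`: `z` if `p ≠ ∞`, and `1 / z`, with value `0` at
`∞`, if `p = ∞`. -/
def sphereCoord (p : OnePoint ℂ) : OnePoint ℂ → ℂ :=
  p.elim (fun q => q.elim 0 (fun z => z⁻¹)) (fun _ => affineCoord)

/-- The inverse of the local coordinate used at the point `p`. -/
def sphereParam (p : OnePoint ℂ) : ℂ → OnePoint ℂ :=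
  open Classical in
  p.elim (fun w => if w = 0 then ∞ else ((w⁻¹ : ℂ) : OnePoint ℂ)) (fun _ w => (w : OnePoint ℂ))

/-- `f` is holomorphic on a neighbourhood of `p`, as a map from the Riemann sphere to itself. -/
def SphereHolomorphicAt (f : OnePoint ℂ → OnePoint ℂ) (p : OnePoint ℂ) : Prop :=
  ContinuousAt f p ∧
    AnalyticAt ℂ (fun w => sphereCoord (f p) (f (sphereParam p w))) (sphereCoord p p)

/-- The subset `Ω_K ∪ {∞}` of the Riemann sphere. -/
def outerSphereDomain (K : Set ℂ) : Set (OnePoint ℂ) :=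
  insert ∞ ((fun z : ℂ => (z : OnePoint ℂ)) '' outerDomain K)

/-- `f(z) ~ A z ^ n` as `z → ∞`, with `A ≠ 0` and `n ≥ 1`; that is, `A = A_f` and `n = n_f`. -/
def HasLeadingTermAtInfinity (f : OnePoint ℂ → OnePoint ℂ) (A : ℂ) (n : ℕ) : Prop :=
  A ≠ 0 ∧ 1 ≤ n ∧
    Asymptotics.IsEquivalent (Bornology.cobounded ℂ)
      (fun z : ℂ => affineCoord (f (z : OnePoint ℂ))) (fun z => A * z ^ n)

/-- `f` extends continuously to `∂Ω_{K₁}`, with `∂Ω_{K₁}` mapped into `∂Ω_{K₂}`. -/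
def ExtendsToBoundary (K₁ K₂ : Set ℂ) (f : OnePoint ℂ → OnePoint ℂ) : Prop :=
  ∃ F : OnePoint ℂ → OnePoint ℂ,
    Set.EqOn F f (outerSphereDomain K₁) ∧
    ContinuousOn F (outerSphereDomain K₁ ∪
      (fun z : ℂ => (z : OnePoint ℂ)) '' frontier (outerDomain K₁)) ∧
    ∀ ζ ∈ frontier (outerDomain K₁), ∃ ω ∈ frontier (outerDomain K₂),
      F (ζ : OnePoint ℂ) = (ω : OnePoint ℂ)

end

noncomputable section

open InnerProductSpace (HarmonicAt HarmonicOnNhd)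

/-! ### The logarithmic kernel, shifted so as to be nonnegative on sets of bounded diameter -/

/-! For an equilibrium measure `μ` of `K₂` with finite Robin constant `V₂`, Frostman's bound `U^μ ≤
V₂` holds on the whole plane, so `g₂ = V₂ - U^μ` is nonnegative, and `g₂(z) = log |z| + V₂ + o(1)`
at infinity. Hence `g₂(f(z)) / n` is harmonic and nonnegative away from the poles of `f`, and equals
`log |z| + (V₂ + log |A|) / n + o(1)`.

Inequality (a) compares it with polynomials. If `V` is below the Robin constant of `K₁`, Leja-type
points give a monic `q` of degree `d` with zeros in `K₁` and `|q| ≤ exp (-V d)` on `K₁`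
(`exists_prod_norm_sub_le`). Then `log |q| / d + V` has upper boundary limits at most `0` and equals
`log |z| + V + o(1)` at infinity. A maximum principle for functions with a logarithmic pole
(`le_of_boundary_of_log_pole`) gives `V ≤ (V₂ + log |A|) / n`. Only Frostman's upper bound on `K₂`
is needed; nothing is assumed about boundary values of the Green's function of `K₁`.

In (b), regularity and the boundary extension make `g = g₂(f) / n` vanish at every boundary point.
Comparison with `h = V₁ - U^{μ₁} ≥ 0` gives `g ≤ h` and the reverse inequality of the constants at
infinity. So `h - g` is nonnegative, harmonic and zero at infinity, and vanishes by the strong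
minimum principle (`eq_sub_realLogPotential`). This yields regularity of the source and equality of
capacities. The formula for Green's functions also needs uniqueness, which follows from an extended
maximum principle (`nonpos_of_quasiAlmostEverywhere`) whose barriers are again logarithms of
polynomials, this time very small on a compact set of capacity zero.

For the corollary, one inequality is the argument of (a) on the full complement of the preimage. The
other pushes the equilibrium measure of the preimage forward by the polynomial: factoring `P - y`
into its roots bounds the potential of the image measure by `n V₁ - log |a_n|`. -/

lemma erealIntegral_congr {μ : Measure ℂ} {u v : ℂ → EReal} (h : u =ᵐ[μ] v) :
    erealIntegral μ u = erealIntegral μ v := by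
  unfold erealIntegral
  rw [lintegral_congr_ae (h.mono fun z hz => by dsimp only; rw [hz] :
      (fun z => (u z).toENNReal) =ᵐ[μ] fun z => (v z).toENNReal),
    lintegral_congr_ae (h.mono fun z hz => by dsimp only; rw [hz] :
      (fun z => (-u z).toENNReal) =ᵐ[μ] fun z => (-v z).toENNReal)]

lemma EReal.toENNReal_add_add_toENNReal_neg {c : ℝ} (hc : 0 ≤ c) {x : EReal}
    (hx : ((-c : ℝ) : EReal) ≤ x) :
    (x + c).toENNReal + (-x).toENNReal = x.toENNReal + ENNReal.ofReal c := by
  induction x with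
  | bot => simp at hx
  | top => simp
  | coe x =>
    have hx' : -c ≤ x := by exact_mod_cast hx
    rw [← EReal.coe_add, ← EReal.coe_neg]
    simp only [EReal.real_coe_toENNReal]
    rcases le_total 0 x with h | h
    · rw [ENNReal.ofReal_of_nonpos (p := -x) (by linarith), add_zero, ENNReal.ofReal_add h hc]
    · rw [ENNReal.ofReal_of_nonpos (p := x) h, zero_add, ← ENNReal.ofReal_add (by linarith)
        (by linarith)]
      congr 1; ring

/-- The negative part has integral at most `c`, so the defining difference is never `∞ - ∞`. From
here on, potentials and energies become integrals of nonnegative functions, to which Tonelli, Fatou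
and monotone convergence apply. -/
lemma erealIntegral_eq_lintegral_sub {μ : Measure ℂ} [IsProbabilityMeasure μ] {u : ℂ → EReal}
    (hu : AEMeasurable u μ) {c : ℝ} (hc : 0 ≤ c) (h : ∀ᵐ z ∂μ, ((-c : ℝ) : EReal) ≤ u z) :
    erealIntegral μ u = ((∫⁻ z, (u z + c).toENNReal ∂μ : ENNReal) : EReal) - c := by
  have h1 : (∫⁻ z, (u z + c).toENNReal ∂μ) + ∫⁻ z, (-u z).toENNReal ∂μ
      = (∫⁻ z, (u z).toENNReal ∂μ) + ENNReal.ofReal c := by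
    rw [← lintegral_add_right' _ (by fun_prop),
      lintegral_congr_ae (h.mono fun z hz => EReal.toENNReal_add_add_toENNReal_neg hc hz),
      lintegral_add_right _ measurable_const]
    simp
  have h2 : ∫⁻ z, (-u z).toENNReal ∂μ ≠ ⊤ := by
    apply ne_top_of_le_ne_top (b := ∫⁻ z, ENNReal.ofReal c ∂μ) (by simp)
    refine lintegral_mono_ae (h.mono fun z hz => ?_)
    rw [← EReal.real_coe_toENNReal]
    apply EReal.toENNReal_le_toENNReal
    rw [EReal.neg_le]
    exact_mod_cast hz
  unfold erealIntegral
  generalize (∫⁻ z, (u z + c).toENNReal ∂μ) = A at *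
  generalize (∫⁻ z, (-u z).toENNReal ∂μ) = B at *
  generalize (∫⁻ z, (u z).toENNReal ∂μ) = C at *
  obtain ⟨b, hb, rfl⟩ : ∃ b : ℝ, 0 ≤ b ∧ B = ENNReal.ofReal b :=
    ⟨B.toReal, ENNReal.toReal_nonneg, (ENNReal.ofReal_toReal h2).symm⟩
  have h3 : (A : EReal) + (b : EReal) = C + c := by
    have := congrArg (fun x : ENNReal => (x : EReal)) h1
    simpa only [EReal.coe_ennreal_add, EReal.coe_ennreal_ofReal, max_eq_left hc, max_eq_left hb]
      using this
  rw [EReal.coe_ennreal_ofReal, max_eq_left hb]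
  have h4 : (C : EReal) = A + b - c := by rw [h3, EReal.add_sub_cancel_right]
  rw [h4]
  generalize (A : EReal) = x
  induction x with
  | bot => simp
  | top => simp
  | coe x =>
    norm_cast
    ring

lemma logKernel_self (z : ℂ) : logKernel z z = ⊤ := by simp [logKernel]

lemma logKernel_of_ne {z t : ℂ} (h : z ≠ t) : logKernel z t = ((-Real.log ‖z - t‖ : ℝ) : EReal) := by
  rw [logKernel, edist_dist, ENNReal.log_ofReal_of_pos (dist_pos.2 h), dist_eq_norm, EReal.coe_neg]

lemma logKernel_comm (z t : ℂ) : logKernel z t = logKernel t z := by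
  rw [logKernel, logKernel, edist_comm]

lemma le_logKernel {z t : ℂ} {c : ℝ} (h : ‖z - t‖ ≤ Real.exp c) :
    ((-c : ℝ) : EReal) ≤ logKernel z t := by
  rcases eq_or_ne z t with rfl | hne
  · simp [logKernel_self]
  · rw [logKernel_of_ne hne, EReal.coe_le_coe_iff, neg_le_neg_iff,
      Real.log_le_iff_le_exp (norm_pos_iff.2 (sub_ne_zero.2 hne))]
    exact h

lemma continuous_logKernel : Continuous fun p : ℂ × ℂ => logKernel p.1 p.2 :=
  (ENNReal.continuous_log.comp continuous_edist).neg

/-- The kernel `log (1 / |z - t|) + c`, with negative values replaced by zero. -/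
def shiftedKernel (c : ℝ) (z t : ℂ) : ENNReal := (logKernel z t + c).toENNReal

/-- The potential of `μ` with respect to the shifted kernel. -/
def shiftedPotential (c : ℝ) (μ : Measure ℂ) (z : ℂ) : ENNReal := ∫⁻ t, shiftedKernel c z t ∂μ

/-- The energy of `μ` with respect to the shifted kernel. -/
def shiftedEnergy (c : ℝ) (μ : Measure ℂ) : ENNReal := ∫⁻ z, shiftedPotential c μ z ∂μ

lemma continuous_shiftedKernel (c : ℝ) : Continuous fun p : ℂ × ℂ => shiftedKernel c p.1 p.2 := by
  refine EReal.continuous_toENNReal.comp (continuous_iff_continuousAt.2 fun p => ?_)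
  exact (EReal.continuousAt_add (p := (logKernel p.1 p.2, (c : EReal))) (by simp) (by simp)).comp
    (f := fun p : ℂ × ℂ => (logKernel p.1 p.2, (c : EReal)))
    (continuous_logKernel.prodMk continuous_const).continuousAt

lemma measurable_shiftedKernel (c : ℝ) : Measurable fun p : ℂ × ℂ => shiftedKernel c p.1 p.2 :=
  (continuous_shiftedKernel c).measurable

lemma measurable_shiftedKernel_right (c : ℝ) (z : ℂ) : Measurable (shiftedKernel c z) :=
  ((continuous_shiftedKernel c).comp (Continuous.prodMk_right z)).measurable

lemma measurable_shiftedPotential (c : ℝ) (μ : Measure ℂ) [SFinite μ] :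
    Measurable (shiftedPotential c μ) :=
  Measurable.lintegral_prod_right' (measurable_shiftedKernel c)

lemma shiftedKernel_comm (c : ℝ) (z t : ℂ) : shiftedKernel c z t = shiftedKernel c t z := by
  rw [shiftedKernel, logKernel_comm, shiftedKernel]

lemma shiftedKernel_self (c : ℝ) (z : ℂ) : shiftedKernel c z z = ⊤ := by
  simp [shiftedKernel, logKernel_self]

lemma shiftedKernel_of_ne (c : ℝ) {z t : ℂ} (h : z ≠ t) :
    shiftedKernel c z t = ENNReal.ofReal (c - Real.log ‖z - t‖) := by
  rw [shiftedKernel, logKernel_of_ne h, ← EReal.coe_add, EReal.real_coe_toENNReal]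
  congr 1; ring

lemma exists_norm_sub_le_exp {K L : Set ℂ} (hK : IsCompact K) (hL : IsCompact L) :
    ∃ c : ℝ, 0 ≤ c ∧ ∀ z ∈ L, ∀ t ∈ K, ‖z - t‖ ≤ Real.exp c := by
  obtain ⟨A, hA⟩ := hK.isBounded.exists_norm_le
  obtain ⟨B, hB⟩ := hL.isBounded.exists_norm_le
  refine ⟨|A| + |B|, by positivity, fun z hz t ht => (norm_sub_le _ _).trans ?_⟩
  have h1 := Real.add_one_le_exp (|A| + |B|)
  linarith [hA t ht, hB z hz, le_abs_self A, le_abs_self B]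

lemma ae_mem_of_mem_probMeasuresOn {K : Set ℂ} {μ : Measure ℂ} (hμ : μ ∈ probMeasuresOn K) :
    ∀ᵐ t ∂μ, t ∈ K := hμ.2

lemma logPotential_eq_shiftedPotential_sub {K : Set ℂ} {μ : Measure ℂ} (hμ : μ ∈ probMeasuresOn K)
    {c : ℝ} (hc : 0 ≤ c) {z : ℂ} (hz : ∀ t ∈ K, ‖z - t‖ ≤ Real.exp c) :
    logPotential μ z = (shiftedPotential c μ z : EReal) - c := by
  have := hμ.1
  refine erealIntegral_eq_lintegral_sub ?_ hc ?_
  · exact (continuous_logKernel.comp (Continuous.prodMk_right z)).measurable.aemeasurable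
  · filter_upwards [ae_mem_of_mem_probMeasuresOn hμ] with t ht using le_logKernel (hz t ht)

lemma logEnergy_eq_shiftedEnergy_sub {K : Set ℂ} {μ : Measure ℂ} (hμ : μ ∈ probMeasuresOn K)
    {c : ℝ} (hc : 0 ≤ c) (hK : ∀ z ∈ K, ∀ t ∈ K, ‖z - t‖ ≤ Real.exp c) :
    logEnergy μ = (shiftedEnergy c μ : EReal) - c := by
  have := hμ.1
  have h : logPotential μ =ᵐ[μ] fun z => (shiftedPotential c μ z : EReal) - c := by
    filter_upwards [ae_mem_of_mem_probMeasuresOn hμ] with z hz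
      using logPotential_eq_shiftedPotential_sub hμ hc (hK z hz)
  have h2 : ∀ x : ENNReal, (((x : EReal) - c) + c).toENNReal = x := fun x => by
    rw [EReal.sub_add_cancel, EReal.toENNReal_coe]
  rw [logEnergy, erealIntegral_congr h, erealIntegral_eq_lintegral_sub _ hc]
  · simp_rw [h2]; rfl
  · refine Eventually.of_forall fun z => ?_
    rw [EReal.coe_neg, ← zero_sub]
    exact EReal.sub_le_sub (EReal.coe_ennreal_nonneg _) le_rfl
  · have : Measurable fun x : EReal => x - c := by
      have : Continuous fun x : EReal => x + ((-c : ℝ) : EReal) := continuous_iff_continuousAt.2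
        fun x => (EReal.continuousAt_add (p := (x, ((-c : ℝ) : EReal))) (by simp) (by simp)).comp
          (f := fun x : EReal => (x, ((-c : ℝ) : EReal)))
          (continuous_id.prodMk continuous_const).continuousAt
      exact this.measurable
    exact (this.comp ((measurable_shiftedPotential c μ).coe_ereal_ennreal)).aemeasurable

/-! ### Existence of equilibrium measures, and Leja points -/

lemma map_val_mem_probMeasuresOn {K : Set ℂ} (hK : IsCompact K) (ν : ProbabilityMeasure K) :
    (ν : Measure K).map Subtype.val ∈ probMeasuresOn K := by
  refine ⟨Measure.isProbabilityMeasure_map measurable_subtype_coe.aemeasurable, ?_⟩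
  rw [Measure.map_apply measurable_subtype_coe hK.measurableSet.compl]
  simp

lemma exists_map_val_eq {K : Set ℂ} (hK : IsCompact K) {μ : Measure ℂ}
    (hμ : μ ∈ probMeasuresOn K) :
    ∃ ν : ProbabilityMeasure K, (ν : Measure K).map Subtype.val = μ := by
  have := hμ.1
  have h : (μ.comap (Subtype.val : K → ℂ)).map Subtype.val = μ := by
    rw [(MeasurableEmbedding.subtype_coe hK.measurableSet).map_comap, Subtype.range_coe]
    exact Measure.restrict_eq_self_of_ae_mem (ae_mem_of_mem_probMeasuresOn hμ)
  refine ⟨⟨μ.comap Subtype.val, ⟨?_⟩⟩, h⟩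
  have h2 := congrArg (fun m : Measure ℂ => m Set.univ) h
  simpa [Measure.map_apply measurable_subtype_coe] using h2

/-- The energy with respect to the shifted kernel truncated at height `n`. -/
def truncatedEnergy {K : Set ℂ} (c : ℝ) (n : ℕ) (ν : ProbabilityMeasure K) : ENNReal :=
  ∫⁻ p : K × K, min (shiftedKernel c p.1 p.2) n ∂(ν.prod ν : Measure (K × K))

lemma continuous_subtype_shiftedKernel {K : Set ℂ} (c : ℝ) :
    Continuous fun p : K × K => shiftedKernel c p.1 p.2 :=
  Continuous.comp (g := fun p : ℂ × ℂ => shiftedKernel c p.1 p.2)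
    (f := fun p : K × K => ((p.1 : ℂ), (p.2 : ℂ))) (continuous_shiftedKernel c) (by fun_prop)

/-- The truncated kernel is a finite continuous function on the compact space `K × K`, and `ν ↦ ν ×
ν` is continuous for weak convergence. -/
lemma continuous_truncatedEnergy {K : Set ℂ} (hK : IsCompact K) (c : ℝ) (n : ℕ) :
    Continuous (truncatedEnergy c n : ProbabilityMeasure K → ENNReal) := by
  have : CompactSpace K := isCompact_iff_compactSpace.1 hK
  have h0 : ∀ p : K × K, min (shiftedKernel c p.1 p.2) (n : ENNReal) ≠ ⊤ := fun p =>
    ne_top_of_le_ne_top (ENNReal.natCast_ne_top n) (min_le_right _ _)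
  let φ : C(K × K, NNReal) := ⟨fun p => (min (shiftedKernel c p.1 p.2) (n : ENNReal)).toNNReal,
    ENNReal.continuousOn_toNNReal.comp_continuous
      ((continuous_subtype_shiftedKernel c).min continuous_const) h0⟩
  have h := (ProbabilityMeasure.continuous_lintegral_continuousMap φ).comp
    (ProbabilityMeasure.continuous_prod.comp
      (continuous_id.prodMk continuous_id : Continuous fun ν : ProbabilityMeasure K => (ν, ν)))
  refine h.congr fun ν => ?_
  exact lintegral_congr fun p => ENNReal.coe_toNNReal (h0 p)

/-- Monotone convergence in the truncation height. As a supremum of continuous functions, the energy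
is lower semicontinuous in the measure. -/
lemma shiftedEnergy_map_val {K : Set ℂ} (c : ℝ) (ν : ProbabilityMeasure K) :
    shiftedEnergy c ((ν : Measure K).map Subtype.val) = ⨆ n : ℕ, truncatedEnergy c n ν := by
  have hm := (continuous_subtype_shiftedKernel (K := K) c).measurable
  unfold truncatedEnergy
  rw [← lintegral_iSup (fun n => hm.min measurable_const)
    (fun m n hmn p => min_le_min_left _ (by exact_mod_cast hmn))]
  have h : ∀ p : K × K, ⨆ n : ℕ, min (shiftedKernel c p.1 p.2) (n : ENNReal)
      = shiftedKernel c p.1 p.2 := fun p => by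
    rw [← inf_iSup_eq, ENNReal.iSup_natCast, inf_top_eq]
  simp_rw [h]
  rw [ProbabilityMeasure.toMeasure_prod, lintegral_prod _ hm.aemeasurable, shiftedEnergy,
    lintegral_map (measurable_shiftedPotential c _) measurable_subtype_coe]
  refine lintegral_congr fun z => ?_
  rw [shiftedPotential, lintegral_map (measurable_shiftedKernel_right c z) measurable_subtype_coe]

lemma le_robinConstant {K : Set ℂ} {c : ℝ} (hc : 0 ≤ c)
    (hK : ∀ z ∈ K, ∀ t ∈ K, ‖z - t‖ ≤ Real.exp c) : ((-c : ℝ) : EReal) ≤ robinConstant K := by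
  refine le_iInf₂ fun μ hμ => ?_
  rw [logEnergy_eq_shiftedEnergy_sub hμ hc hK, EReal.coe_neg, ← zero_sub]
  exact EReal.sub_le_sub (EReal.coe_ennreal_nonneg _) le_rfl

lemma robinConstant_ne_bot {K : Set ℂ} (hK : IsCompact K) : robinConstant K ≠ ⊥ := by
  obtain ⟨c, hc, h⟩ := exists_norm_sub_le_exp hK hK
  exact ne_bot_of_le_ne_bot (EReal.coe_ne_bot _) (le_robinConstant hc h)

/-- A lower semicontinuous function attains its minimum on the weakly compact space of probability
measures on `K`. -/
theorem exists_isEquilibriumMeasure {K : Set ℂ} (hK : IsCompact K) (hne : K.Nonempty) :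
    ∃ μ, IsEquilibriumMeasure K μ := by
  obtain ⟨c, hc, h⟩ := exists_norm_sub_le_exp hK hK
  have : CompactSpace K := isCompact_iff_compactSpace.1 hK
  obtain ⟨x, hx⟩ := hne
  have hlsc : LowerSemicontinuous fun ν : ProbabilityMeasure K =>
      shiftedEnergy c ((ν : Measure K).map Subtype.val) := by
    simp_rw [shiftedEnergy_map_val]
    exact lowerSemicontinuous_iSup fun n => (continuous_truncatedEnergy hK c n).lowerSemicontinuous
  obtain ⟨ν, -, hν⟩ := LowerSemicontinuousOn.exists_isMinOn
    (s := (Set.univ : Set (ProbabilityMeasure K)))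
    ⟨⟨Measure.dirac ⟨x, hx⟩, inferInstance⟩, trivial⟩ isCompact_univ (hlsc.lowerSemicontinuousOn _)
  refine ⟨_, map_val_mem_probMeasuresOn hK ν, le_antisymm (le_iInf₂ fun μ hμ => ?_)
    (iInf₂_le _ (map_val_mem_probMeasuresOn hK ν))⟩
  obtain ⟨ρ, rfl⟩ := exists_map_val_eq hK hμ
  rw [logEnergy_eq_shiftedEnergy_sub (map_val_mem_probMeasuresOn hK ν) hc h,
    logEnergy_eq_shiftedEnergy_sub (map_val_mem_probMeasuresOn hK ρ) hc h]
  exact EReal.sub_le_sub (EReal.coe_ennreal_le_coe_ennreal_iff.2 (hν (Set.mem_univ ρ))) le_rfl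

theorem isEquilibriumMeasure_equilibriumMeasure {K : Set ℂ} (hK : IsCompact K)
    (hne : K.Nonempty) : IsEquilibriumMeasure K (equilibriumMeasure K) :=
  Classical.epsilon_spec (exists_isEquilibriumMeasure hK hne)

lemma logCapacity_of_robinConstant_eq {K : Set ℂ} {V : ℝ} (h : robinConstant K = V) :
    logCapacity K = Real.exp (-V) := by
  rw [logCapacity, h, ← EReal.coe_neg, EReal.exp_coe, ENNReal.toReal_ofReal (Real.exp_pos _).le]

lemma logCapacity_of_robinConstant_eq_top {K : Set ℂ} (h : robinConstant K = ⊤) :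
    logCapacity K = 0 := by
  rw [logCapacity, h, EReal.neg_top, EReal.exp_bot, ENNReal.toReal_zero]

lemma robinConstant_eq_top_or_coe {K : Set ℂ} (hK : IsCompact K) :
    robinConstant K = ⊤ ∨ ∃ V : ℝ, robinConstant K = V := by
  have := robinConstant_ne_bot hK
  generalize robinConstant K = x at *
  induction x with
  | bot => exact absurd rfl this
  | top => exact Or.inl rfl
  | coe x => exact Or.inr ⟨x, rfl⟩

lemma exists_robinConstant_eq {K : Set ℂ} (hK : IsCompact K) (h : 0 < logCapacity K) :
    ∃ V : ℝ, robinConstant K = V :=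
  (robinConstant_eq_top_or_coe hK).resolve_left fun h' =>
    h.ne' (logCapacity_of_robinConstant_eq_top h')

lemma robinConstant_eq_top {K : Set ℂ} (hK : IsCompact K) (h : logCapacity K = 0) :
    robinConstant K = ⊤ :=
  (robinConstant_eq_top_or_coe hK).resolve_right fun ⟨V, hV⟩ =>
    (Real.exp_pos (-V)).ne' ((logCapacity_of_robinConstant_eq hV).symm.trans h)

/-- Recursive choice of a sequence whose `n`-th term depends on the previous ones. -/
lemma exists_seq_of_forall_exists {α : Type*} [Nonempty α] {P : ℕ → (ℕ → α) → α → Prop}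
    (hP : ∀ n x y z, (∀ i < n, x i = y i) → P n x z → P n y z) (h : ∀ n x, ∃ z, P n x z) :
    ∃ x : ℕ → α, ∀ n, P n x (x n) := by
  choose F hF using h
  let y : ℕ → ℕ → α := fun n => Nat.rec (fun _ => Classical.arbitrary α)
    (fun n x => Function.update x n (F n x)) n
  have hy : ∀ n, y (n + 1) = Function.update (y n) n (F n (y n)) := fun n => rfl
  have hyx : ∀ n, ∀ i < n, y n i = y (i + 1) i := by
    intro n
    induction n with
    | zero => intro i hi; omega
    | succ n ih =>
      intro i hi
      rcases Nat.lt_succ_iff_lt_or_eq.1 hi with h | rfl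
      · rw [hy, Function.update_of_ne h.ne, ih i h]
      · rfl
  refine ⟨fun n => y (n + 1) n, fun n => hP n (y n) _ _ (hyx n) ?_⟩
  dsimp only
  rw [hy, Function.update_self]
  exact hF n (y n)

/-- By symmetry, enlarging the square from `n` to `n + 1` adds twice the new row and one diagonal
term. The diagonal is counted separately because only there is the bound `m` on the truncated kernel
needed. -/
lemma sum_sum_le_of_symm {T : ℕ → ℕ → ENNReal} (hT : ∀ i j, T i j = T j i) {m A : ENNReal}
    (hm : ∀ i, T i i ≤ m) (hA : ∀ n, ∑ i ∈ Finset.range n, T n i ≤ n * A) (n : ℕ) :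
    ∑ i ∈ Finset.range n, ∑ j ∈ Finset.range n, T i j ≤ n * m + n * n * A := by
  induction n with
  | zero => simp
  | succ n ih =>
    have h : ∑ i ∈ Finset.range (n + 1), ∑ j ∈ Finset.range (n + 1), T i j
        = (∑ i ∈ Finset.range n, ∑ j ∈ Finset.range n, T i j) + ∑ i ∈ Finset.range n, T n i
          + (∑ i ∈ Finset.range n, T n i + T n n) := by
      rw [Finset.sum_range_succ, Finset.sum_range_succ (fun j => T n j)]
      simp_rw [Finset.sum_range_succ (fun j => T _ j) n]
      rw [Finset.sum_add_distrib]
      simp_rw [hT _ n]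
    rw [h]
    calc _ ≤ (n * m + n * n * A) + n * A + (n * A + m) := by gcongr <;> simp [hA, hm]
      -- The additional `A` completes the square `(n + 1) * (n + 1) * A`.
      _ ≤ (n * m + n * n * A) + n * A + (n * A + m) + A := le_self_add
      _ = _ := by push_cast; ring

/-- The uniform probability measure on the first `n + 1` terms of a sequence. -/
def empiricalMeasure {α : Type*} [MeasurableSpace α] (x : ℕ → α) (n : ℕ) : ProbabilityMeasure α :=
  ⟨((n + 1 : ℕ) : ENNReal)⁻¹ • ∑ i ∈ Finset.range (n + 1), Measure.dirac (x i), ⟨by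
    simp only [Measure.smul_apply, Measure.finsetSum_apply, measure_univ, Finset.sum_const,
      Finset.card_range, smul_eq_mul, nsmul_eq_mul, mul_one]
    exact ENNReal.inv_mul_cancel (by simp) (ENNReal.natCast_ne_top _)⟩⟩

lemma lintegral_empiricalMeasure {α : Type*} [MeasurableSpace α] (x : ℕ → α) (n : ℕ)
    {φ : α → ENNReal} (hφ : Measurable φ) :
    ∫⁻ a, φ a ∂(empiricalMeasure x n : Measure α)
      = ((n + 1 : ℕ) : ENNReal)⁻¹ * ∑ i ∈ Finset.range (n + 1), φ (x i) := by
  change ∫⁻ a, φ a ∂(((n + 1 : ℕ) : ENNReal)⁻¹ • ∑ i ∈ Finset.range (n + 1), Measure.dirac (x i)) = _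
  rw [lintegral_smul_measure, lintegral_finsetSum_measure, smul_eq_mul]
  simp_rw [lintegral_dirac' _ hφ]

/-- The diagonal, where the kernel is infinite, contributes at most `n + 1` terms of size `m` after
truncation, with total weight `1 / (n + 1)`. The off-diagonal part is controlled by the row bounds.
-/
lemma truncatedEnergy_empiricalMeasure_le {K : Set ℂ} {c : ℝ} {A : ENNReal} {x : ℕ → K}
    (hA : ∀ n, ∑ i ∈ Finset.range n, shiftedKernel c (x n) (x i) ≤ n * A) (m n : ℕ) :
    truncatedEnergy c m (empiricalMeasure x n) ≤ m / ((n + 1 : ℕ) : ENNReal) + A := by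
  have hm : Measurable fun p : K × K => min (shiftedKernel c p.1 p.2) (m : ENNReal) :=
    ((continuous_subtype_shiftedKernel (K := K) c).min continuous_const).measurable
  rw [truncatedEnergy, ProbabilityMeasure.toMeasure_prod, lintegral_prod _ hm.aemeasurable,
    lintegral_empiricalMeasure x n hm.lintegral_prod_right']
  have h1 : ∀ z : K, ∫⁻ t : K, min (shiftedKernel c z t) (m : ENNReal)
      ∂(empiricalMeasure x n : Measure K) = ((n + 1 : ℕ) : ENNReal)⁻¹ *
        ∑ i ∈ Finset.range (n + 1), min (shiftedKernel c z (x i)) (m : ENNReal) := fun z =>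
    lintegral_empiricalMeasure x n (Measurable.comp
      (g := fun t : ℂ => min (shiftedKernel c z t) (m : ENNReal)) (f := fun t : K => (t : ℂ))
      ((measurable_shiftedKernel_right c z).min measurable_const) measurable_subtype_coe)
  simp_rw [h1]
  rw [← Finset.mul_sum]
  have h2 := sum_sum_le_of_symm
    (T := fun i j => min (shiftedKernel c (x i) (x j)) (m : ENNReal)) (m := m) (A := A)
    (fun i j => by rw [shiftedKernel_comm]) (fun i => min_le_right _ _)
    (fun n => (Finset.sum_le_sum fun i _ => min_le_left _ _).trans (hA n)) (n + 1)
  have h3 : ((n + 1 : ℕ) : ENNReal)⁻¹ * ((n + 1 : ℕ) : ENNReal) = 1 :=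
    ENNReal.inv_mul_cancel (by simp) (ENNReal.natCast_ne_top _)
  calc _ ≤ ((n + 1 : ℕ) : ENNReal)⁻¹ * (((n + 1 : ℕ) : ENNReal)⁻¹ *
        (((n + 1 : ℕ) : ENNReal) * m + ((n + 1 : ℕ) : ENNReal) * ((n + 1 : ℕ) : ENNReal) * A)) := by
        gcongr
    _ = (((n + 1 : ℕ) : ENNReal)⁻¹ * ((n + 1 : ℕ) : ENNReal)) * (m * ((n + 1 : ℕ) : ENNReal)⁻¹)
        + (((n + 1 : ℕ) : ENNReal)⁻¹ * ((n + 1 : ℕ) : ENNReal)) *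
          (((n + 1 : ℕ) : ENNReal)⁻¹ * ((n + 1 : ℕ) : ENNReal)) * A := by ring
    _ = _ := by rw [h3, one_mul, one_mul, one_mul, div_eq_mul_inv]

/-- A weak cluster point of the empirical measures works: at each fixed height `m` the diagonal
error `m / (n + 1)` disappears as `n → ∞`, and afterwards `m` is sent to infinity. -/
lemma exists_shiftedEnergy_le {K : Set ℂ} (hK : IsCompact K) {c : ℝ} {A : ENNReal} {x : ℕ → K}
    (hA : ∀ n, ∑ i ∈ Finset.range n, shiftedKernel c (x n) (x i) ≤ n * A) :
    ∃ μ ∈ probMeasuresOn K, shiftedEnergy c μ ≤ A := by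
  have : CompactSpace K := isCompact_iff_compactSpace.1 hK
  obtain ⟨ν, -, hν⟩ := isCompact_univ (X := ProbabilityMeasure K)
    (f := map (empiricalMeasure x) atTop) (by simp)
  refine ⟨_, map_val_mem_probMeasuresOn hK ν, ?_⟩
  rw [shiftedEnergy_map_val]
  refine iSup_le fun m => le_of_forall_gt_imp_ge_of_dense fun B hB => ?_
  have hlim : Tendsto (fun n : ℕ => (m : ENNReal) / ((n + 1 : ℕ) : ENNReal) + A) atTop (𝓝 A) := by
    have := ENNReal.Tendsto.const_mul (a := (m : ENNReal))
      (ENNReal.tendsto_inv_nat_nhds_zero.comp (tendsto_add_atTop_nat 1))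
      (Or.inr (ENNReal.natCast_ne_top m))
    simpa [div_eq_mul_inv, Function.comp_def] using this.add_const A
  have hev : {ρ : ProbabilityMeasure K | truncatedEnergy c m ρ ≤ B} ∈
      map (empiricalMeasure x) atTop := by
    rw [mem_map]
    filter_upwards [hlim.eventually (gt_mem_nhds hB)] with n hn
    exact (truncatedEnergy_empiricalMeasure_le hA m n).trans hn.le
  have hcl : IsClosed {ρ : ProbabilityMeasure K | truncatedEnergy c m ρ ≤ B} :=
    isClosed_le (continuous_truncatedEnergy hK c m) continuous_const
  exact isClosed_iff_clusterPt.1 hcl ν (ClusterPt.mono hν (le_principal_iff.2 hev))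

/-- If `V` is smaller than the Robin constant of `K`, then some monic polynomial of degree `d` with
zeros in `K` is bounded by `exp (-V d)` on `K`. -/
theorem exists_prod_norm_sub_le {K : Set ℂ} (hK : IsCompact K) (hne : K.Nonempty) {V : ℝ}
    (hV : (V : EReal) < robinConstant K) :
    ∃ (d : ℕ) (x : ℕ → ℂ), 1 ≤ d ∧ (∀ i, x i ∈ K) ∧
      ∀ z ∈ K, ∏ i ∈ Finset.range d, ‖z - x i‖ ≤ Real.exp (-V * d) := by
  by_contra! hcon
  obtain ⟨c, hc, hcK⟩ := exists_norm_sub_le_exp hK hK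
  have : Nonempty K := hne.to_subtype
  -- If no such polynomial exists, each new point can be chosen in `K` where the polynomial with
  -- zeros at the preceding points exceeds `exp (-V n)`. The resulting Leja-type sequence produces a
  -- measure of energy at most `V`, which contradicts `V < V_K`.
  obtain ⟨x, hx⟩ := exists_seq_of_forall_exists
    (P := fun n (x : ℕ → K) (z : K) =>
      Real.exp (-V * n) ≤ ∏ i ∈ Finset.range n, ‖(z : ℂ) - x i‖)
    (fun n x y z hxy h => by
      rwa [Finset.prod_congr rfl fun i hi => by rw [← hxy i (Finset.mem_range.1 hi)]])
    (fun n x => by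
      rcases Nat.eq_zero_or_pos n with rfl | hn
      · exact ⟨Classical.arbitrary K, by simp⟩
      · obtain ⟨z, hz, h⟩ := hcon n (fun i => x i) hn fun i => (x i).2
        exact ⟨⟨z, hz⟩, h.le⟩)
  have hA : ∀ n, ∑ i ∈ Finset.range n, shiftedKernel c (x n) (x i) ≤ n * ENNReal.ofReal (c + V) := by
    intro n
    have hne : ∀ i ∈ Finset.range n, ‖(x n : ℂ) - x i‖ ≠ 0 :=
      Finset.prod_ne_zero_iff.1 ((Real.exp_pos _).trans_le (hx n)).ne'
    have hlog : ∀ i ∈ Finset.range n, 0 ≤ c - Real.log ‖(x n : ℂ) - x i‖ := fun i hi => by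
      have := (Real.log_le_iff_le_exp (by have := hne i hi; positivity)).2
        (hcK _ (x n).2 _ (x i).2)
      linarith
    rw [Finset.sum_congr rfl fun i hi => shiftedKernel_of_ne c
        (sub_ne_zero.1 (norm_ne_zero_iff.1 (hne i hi))),
      ← ENNReal.ofReal_sum_of_nonneg hlog, ← ENNReal.ofReal_natCast, ← ENNReal.ofReal_mul (by simp)]
    apply ENNReal.ofReal_le_ofReal
    have h1 := Real.log_le_log (Real.exp_pos _) (hx n)
    rw [Real.log_exp, Real.log_prod hne] at h1
    rw [Finset.sum_sub_distrib]
    simp only [Finset.sum_const, Finset.card_range, nsmul_eq_mul]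
    linarith
  obtain ⟨μ, hμ, hμA⟩ := exists_shiftedEnergy_le hK hA
  -- The case `n = 1` reads `exp (-V) ≤ |x 1 - x 0|`, and this distance is at most `exp c`.
  have hcV : 0 ≤ c + V := by
    have h1 : Real.exp (-V) ≤ Real.exp c := by
      refine le_trans ?_ (hcK _ (x 1).2 _ (x 0).2)
      simpa using hx 1
    linarith [Real.exp_le_exp.1 h1]
  refine hV.not_ge ((iInf₂_le μ hμ).trans ?_)
  rw [logEnergy_eq_shiftedEnergy_sub hμ hc hcK]
  refine (EReal.sub_le_sub (EReal.coe_ennreal_le_coe_ennreal_iff.2 hμA) le_rfl).trans ?_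
  rw [EReal.coe_ennreal_ofReal, max_eq_left hcV, ← EReal.coe_sub, EReal.coe_le_coe_iff]
  linarith

/-! ### Maximum principles for harmonic functions -/

/-- Near `p`, `v` is the real part of an analytic `F`; the maximum modulus principle applies to `exp
F`, whose modulus is `exp v`. -/
lemma InnerProductSpace.HarmonicAt.eventually_eq_of_isLocalMax {v : ℂ → ℝ} {p : ℂ} (hv : HarmonicAt v p)
    (hmax : ∀ᶠ z in 𝓝 p, v z ≤ v p) : ∀ᶠ z in 𝓝 p, v z = v p := by
  obtain ⟨r, hr, hball⟩ := Metric.eventually_nhds_iff_ball.1 hv.eventually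
  obtain ⟨F, hF, hFv⟩ := InnerProductSpace.HarmonicOnNhd.exists_analyticOnNhd_ball_re_eq
    (f := v) (z := p) (R := r) hball
  have hmem : ∀ᶠ z in 𝓝 p, z ∈ Metric.ball p r := Metric.ball_mem_nhds p hr
  have hn : ∀ z ∈ Metric.ball p r, ‖Complex.exp (F z)‖ = Real.exp (v z) := fun z hz => by
    rw [Complex.norm_exp]; exact congrArg Real.exp (hFv hz)
  have hp := Metric.mem_ball_self (x := p) hr
  have := Complex.eventually_eq_of_isLocalMax_norm (f := fun z => Complex.exp (F z)) (c := p)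
    (hmem.mono fun z hz => (hF z hz).differentiableAt.cexp)
    (by
      filter_upwards [hmax, hmem] with z hz hzr
      simp only [Function.comp_apply]
      rw [hn z hzr, hn p hp]
      exact Real.exp_le_exp.2 hz)
  filter_upwards [this, hmem] with z hz hzr
  have h := congrArg norm hz
  rw [hn z hzr, hn p hp] at h
  exact Real.exp_injective h

/-- Maximum principle on an arbitrary open subset of the plane. -/
theorem InnerProductSpace.HarmonicOnNhd.nonpos_of_boundary {W : Set ℂ} (hW : IsOpen W) {v : ℂ → ℝ}
    (hv : HarmonicOnNhd v W)
    (hb : ∀ ζ ∈ frontier W, ∀ ε > 0, ∀ᶠ z in 𝓝[W] ζ, v z ≤ ε)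
    (hinf : ∀ ε > 0, ∀ᶠ z in Bornology.cobounded ℂ ⊓ 𝓟 W, v z ≤ ε) {z : ℂ} (hz : z ∈ W) :
    v z ≤ 0 := by
  by_contra! hpos
  have hε : 0 < v z / 2 := by positivity
  have hcont : ContinuousOn v W := hv.continuousOn
  set C : Set ℂ := {w | w ∈ W ∧ v z ≤ v w} with hC
  have hCb : Bornology.IsBounded C := by
    have h := hinf _ hε
    rw [eventually_inf_principal] at h
    rw [← Bornology.isCobounded_compl_iff]
    filter_upwards [h] with w hw hwC
    linarith [hw hwC.1, hwC.2]
  -- The superlevel set cannot accumulate at the frontier of `W`, where `v` is eventually at most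
  -- half of `v z`. It is therefore closed in the plane, not merely in `W`, and hence compact.
  have hCc : IsClosed C := by
    refine isClosed_of_closure_subset fun ζ hζ => ?_
    have hζW : ζ ∈ closure W := closure_mono (fun w hw => hw.1) hζ
    have hne : (𝓝[C] ζ).NeBot := mem_closure_iff_nhdsWithin_neBot.1 hζ
    by_cases h : ζ ∈ W
    · refine ⟨h, ?_⟩
      have h1 : Tendsto v (𝓝[C] ζ) (𝓝 (v ζ)) := (hcont ζ h).mono_left
        (nhdsWithin_mono _ fun w hw => hw.1)
      exact ge_of_tendsto h1 (eventually_mem_nhdsWithin.mono fun w hw => hw.2)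
    · exfalso
      have h1 := hb ζ ⟨hζW, by rwa [hW.interior_eq]⟩ _ hε
      have h2 : ∀ᶠ w in 𝓝[C] ζ, v w ≤ v z / 2 :=
        nhdsWithin_mono _ (fun w hw => hw.1) h1
      obtain ⟨w, hw1, hw2⟩ := (h2.and eventually_mem_nhdsWithin).exists
      linarith [hw2.2]
  have hCK : IsCompact C := Metric.isCompact_of_isClosed_isBounded hCc hCb
  obtain ⟨p, hp, hmax⟩ := hCK.exists_isMaxOn ⟨z, hz, le_rfl⟩ (hcont.mono fun w hw => hw.1)
  have hmaxW : ∀ w ∈ W, v w ≤ v p := fun w hw => by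
    by_cases h : v z ≤ v w
    · exact hmax ⟨hw, h⟩
    · exact (not_le.1 h).le.trans hp.2
  -- The set where the maximum is attained is clopen in all of `ℂ`, so it is the plane, although it
  -- lies in the bounded set `C`. This avoids any connectedness assumption on `W`.
  set M : Set ℂ := {w | w ∈ C ∧ v w = v p} with hM
  have hMc : IsClosed M := by
    have := (hcont.mono fun w (hw : w ∈ C) => hw.1).preimage_isClosed_of_isClosed hCc
      (isClosed_singleton (x := v p))
    exact this
  have hMo : IsOpen M := by
    refine isOpen_iff_mem_nhds.2 fun w hw => ?_
    have hwW := hW.mem_nhds hw.1.1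
    have h1 := (hv w hw.1.1).eventually_eq_of_isLocalMax
      (eventually_of_mem hwW fun y hy => (hmaxW y hy).trans_eq hw.2.symm)
    filter_upwards [h1, hwW] with y hy hyW
    exact ⟨⟨hyW, by rw [hy]; exact hw.1.2⟩, hy.trans hw.2⟩
  have hMu : M = Set.univ := IsClopen.eq_univ ⟨hMc, hMo⟩ ⟨p, hp, rfl⟩
  have hub : Bornology.IsBounded (Set.univ : Set ℂ) := hMu ▸ hCb.subset fun w hw => hw.1
  exact NormedSpace.unbounded_univ ℝ ℂ hub

/-- Strong minimum principle. -/
theorem InnerProductSpace.HarmonicOnNhd.eq_zero_of_nonneg {W : Set ℂ} (hW : IsOpen W) (hWc : IsPreconnected W)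
    {k : ℂ → ℝ} (hk : HarmonicOnNhd k W) (hnn : ∀ z ∈ W, 0 ≤ k z) {p : ℂ} (hp : p ∈ W)
    (hp0 : k p = 0) {z : ℂ} (hz : z ∈ W) : k z = 0 := by
  have hcont : ContinuousOn k W := hk.continuousOn
  have hopen : IsOpen {w | w ∈ W ∧ k w = 0} := by
    refine isOpen_iff_mem_nhds.2 fun w hw => ?_
    have hwW := hW.mem_nhds hw.1
    have h1 := (hk w hw.1).neg.eventually_eq_of_isLocalMax
      (eventually_of_mem hwW fun y hy => by simpa [hw.2] using hnn y hy)
    filter_upwards [h1, hwW] with y hy hyW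
    exact ⟨hyW, by simpa [hw.2] using hy⟩
  refine (hWc.subset_of_closure_inter_subset hopen ⟨p, hp, hp, hp0⟩ ?_ hz).2
  rintro w ⟨hw, hwW⟩
  refine ⟨hwW, ?_⟩
  have hne : (𝓝[{w | w ∈ W ∧ k w = 0}] w).NeBot := mem_closure_iff_nhdsWithin_neBot.1 hw
  have h1 : Tendsto k (𝓝[{w | w ∈ W ∧ k w = 0}] w) (𝓝 (k w)) :=
    (hcont w hwW).mono_left (nhdsWithin_mono _ fun y hy => hy.1)
  exact tendsto_nhds_unique h1 (tendsto_const_nhds.congr'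
    (eventually_mem_nhdsWithin.mono fun y hy => hy.2.symm))

/-! ### The unbounded component of the complement of a compact set -/

/-- The exterior of a disc is the image of a half-plane under the exponential. -/
lemma isPreconnected_setOf_lt_norm {ρ : ℝ} (hρ : 0 < ρ) : IsPreconnected {z : ℂ | ρ < ‖z‖} := by
  have h : {z : ℂ | ρ < ‖z‖} = Complex.exp '' {w : ℂ | Real.log ρ < w.re} := by
    ext z
    constructor
    · intro (hz : ρ < ‖z‖)
      have hz0 : z ≠ 0 := norm_pos_iff.1 (hρ.trans hz)
      refine ⟨Complex.log z, ?_, Complex.exp_log hz0⟩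
      simpa [Complex.log_re] using Real.log_lt_log hρ hz
    · rintro ⟨w, hw, rfl⟩
      change ρ < ‖Complex.exp w‖
      rw [Complex.norm_exp]
      exact (Real.log_lt_iff_lt_exp hρ).1 hw
  rw [h]
  exact (convex_halfSpace_re_gt _).isPreconnected.image _ Complex.continuous_exp.continuousOn

section outerDomain

variable {K : Set ℂ}

lemma exists_setOf_lt_norm_subset (hK : IsCompact K) :
    ∃ ρ : ℝ, 0 < ρ ∧ K ⊆ Metric.closedBall 0 ρ ∧ {z : ℂ | ρ < ‖z‖} ⊆ Kᶜ := by
  obtain ⟨ρ, hρ⟩ := hK.isBounded.exists_norm_le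
  refine ⟨|ρ| + 1, by positivity, fun z hz => ?_, fun z hz hzK => ?_⟩
  · rw [mem_closedBall_zero_iff]; linarith [hρ z hz, le_abs_self ρ]
  · have hz' : |ρ| + 1 < ‖z‖ := hz
    linarith [hρ z hzK, le_abs_self ρ]

lemma not_isBounded_setOf_lt_norm (ρ : ℝ) : ¬ Bornology.IsBounded {z : ℂ | ρ < ‖z‖} := by
  intro h
  refine NormedSpace.unbounded_univ ℝ ℂ ((h.union (Metric.isBounded_closedBall (x := (0 : ℂ))
    (r := ρ))).subset fun z _ => ?_)
  rcases lt_or_ge ρ ‖z‖ with h | h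
  · exact Or.inl h
  · exact Or.inr (by simpa using h)

lemma connectedComponentIn_subset_outerDomain {z : ℂ} (hz : z ∈ outerDomain K) :
    connectedComponentIn Kᶜ z ⊆ outerDomain K := fun w hw =>
  ⟨connectedComponentIn_subset _ _ hw, by rw [← connectedComponentIn_eq hw]; exact hz.2⟩

lemma isOpen_outerDomain (hK : IsCompact K) : IsOpen (outerDomain K) :=
  isOpen_iff_mem_nhds.2 fun _ hz => mem_of_superset
    ((hK.isClosed.isOpen_compl.connectedComponentIn).mem_nhds (mem_connectedComponentIn hz.1))
    (connectedComponentIn_subset_outerDomain hz)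

/-- An unbounded component meets the exterior of the disc, which is connected and misses `K`.
Consequently there is only one unbounded component. -/
lemma setOf_lt_norm_subset_connectedComponentIn {ρ : ℝ} (hρ : 0 < ρ)
    (h : {z : ℂ | ρ < ‖z‖} ⊆ Kᶜ) {z : ℂ} (hz : z ∈ outerDomain K) :
    {z : ℂ | ρ < ‖z‖} ⊆ connectedComponentIn Kᶜ z := by
  obtain ⟨p, hp, hpρ⟩ : ∃ p ∈ connectedComponentIn Kᶜ z, ρ < ‖p‖ := by
    by_contra! hcon
    exact hz.2 (Metric.isBounded_closedBall.subset fun p hp =>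
      mem_closedBall_zero_iff.2 (hcon p hp))
  rw [connectedComponentIn_eq hp]
  exact (isPreconnected_setOf_lt_norm hρ).subset_connectedComponentIn hpρ h

lemma setOf_lt_norm_subset_outerDomain {ρ : ℝ} (hρ : 0 < ρ) (h : {z : ℂ | ρ < ‖z‖} ⊆ Kᶜ) :
    {z : ℂ | ρ < ‖z‖} ⊆ outerDomain K := fun _ hz =>
  ⟨h hz, fun hb => not_isBounded_setOf_lt_norm ρ
    (hb.subset ((isPreconnected_setOf_lt_norm hρ).subset_connectedComponentIn hz h))⟩

lemma outerDomain_mem_cobounded (hK : IsCompact K) : outerDomain K ∈ Bornology.cobounded ℂ := by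
  obtain ⟨ρ, hρ, -, h⟩ := exists_setOf_lt_norm_subset hK
  filter_upwards [tendsto_norm_cobounded_atTop.eventually_gt_atTop ρ] with z hz
  exact setOf_lt_norm_subset_outerDomain hρ h hz

lemma isPreconnected_outerDomain (hK : IsCompact K) : IsPreconnected (outerDomain K) := by
  obtain ⟨ρ, hρ, -, h⟩ := exists_setOf_lt_norm_subset hK
  have hp : ρ < ‖((ρ + 1 : ℝ) : ℂ)‖ := by
    rw [Complex.norm_real, Real.norm_eq_abs, abs_of_pos (by linarith)]; linarith
  have hpΩ := setOf_lt_norm_subset_outerDomain hρ h hp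
  have heq : outerDomain K = connectedComponentIn Kᶜ ((ρ + 1 : ℝ) : ℂ) := by
    refine Set.Subset.antisymm (fun z hz => ?_) (connectedComponentIn_subset_outerDomain hpΩ)
    rw [← connectedComponentIn_eq (setOf_lt_norm_subset_connectedComponentIn hρ h hz hp)]
    exact mem_connectedComponentIn hz.1
  rw [heq]
  exact isPreconnected_connectedComponentIn

lemma outerDomain_subset_compl : outerDomain K ⊆ Kᶜ := fun _ hz => hz.1

/-- A frontier point off `K` would have its own component of the complement as a neighbourhood; that
component meets `Ω_K`, so the point would be interior to `Ω_K`. -/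
lemma frontier_outerDomain_subset (hK : IsCompact K) : frontier (outerDomain K) ⊆ K := by
  intro ζ hζ
  by_contra hζK
  have hO : connectedComponentIn Kᶜ ζ ∈ 𝓝 ζ :=
    (hK.isClosed.isOpen_compl.connectedComponentIn).mem_nhds (mem_connectedComponentIn hζK)
  obtain ⟨w, hw, hwΩ⟩ := mem_closure_iff_nhds.1 hζ.1 _ hO
  refine hζ.2 ((isOpen_outerDomain hK).interior_eq.symm ▸
    connectedComponentIn_subset_outerDomain hwΩ ?_)
  rw [← connectedComponentIn_eq hw]
  exact mem_connectedComponentIn hζK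

end outerDomain

/-! ### Logarithmic potentials as real integrals -/

/-- The potential of `μ` as a Bochner integral. -/
def realLogPotential (μ : Measure ℂ) (z : ℂ) : ℝ := -∫ t, Real.log ‖z - t‖ ∂μ

lemma measurable_log_norm_sub (z : ℂ) : Measurable fun t : ℂ => Real.log ‖z - t‖ :=
  Real.measurable_log.comp (measurable_const.sub measurable_id).norm

section

variable {K : Set ℂ} {μ : Measure ℂ}

lemma integrable_log_norm_sub_of_notMem (hK : IsCompact K) (hμ : μ ∈ probMeasuresOn K) {z : ℂ}
    (hz : z ∉ K) : Integrable (fun t => Real.log ‖z - t‖) μ := by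
  have := hμ.1
  have hc : ContinuousOn (fun t : ℂ => Real.log ‖z - t‖) K := fun t ht =>
    ((continuous_const.sub continuous_id).norm.continuousAt.log
      (norm_ne_zero_iff.2 (sub_ne_zero.2 fun h : z = t => hz (h ▸ ht)))).continuousWithinAt
  obtain ⟨C, hC⟩ := hK.exists_bound_of_continuousOn hc
  refine Integrable.of_bound (measurable_log_norm_sub z).aestronglyMeasurable C ?_
  filter_upwards [ae_mem_of_mem_probMeasuresOn hμ] with t ht using hC t ht

lemma shiftedPotential_eq_ofReal [IsProbabilityMeasure μ] {c : ℝ} {z : ℂ}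
    (hi : Integrable (fun t => Real.log ‖z - t‖) μ) (hz : μ {z} = 0)
    (hc : ∀ᵐ t ∂μ, ‖z - t‖ ≤ Real.exp c) :
    shiftedPotential c μ z = ENNReal.ofReal (c + realLogPotential μ z) := by
  have hne : ∀ᵐ t ∂μ, t ≠ z := measure_eq_zero_iff_ae_notMem.1 hz
  have h1 : shiftedPotential c μ z = ∫⁻ t, ENNReal.ofReal (c - Real.log ‖z - t‖) ∂μ := by
    refine lintegral_congr_ae ?_
    filter_upwards [hne] with t ht using shiftedKernel_of_ne c ht.symm
  have h2 : Integrable (fun t => c - Real.log ‖z - t‖) μ := (integrable_const c).sub hi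
  rw [h1, ← ofReal_integral_eq_lintegral_ofReal h2, integral_sub (integrable_const c) hi]
  · simp [realLogPotential, sub_eq_add_neg]
  · filter_upwards [hne, hc] with t ht htc
    have := (Real.log_le_iff_le_exp (norm_pos_iff.2 (sub_ne_zero.2 ht.symm))).2 htc
    simpa using this

/-- The kernel is `⊤` on the diagonal, so a finite potential excludes an atom at `z`. This matters
because `Real.log 0 = 0` would hide an atom from the Bochner integral. -/
lemma integrable_of_shiftedPotential_ne_top [IsProbabilityMeasure μ] {c : ℝ} {z : ℂ}
    (hc : ∀ᵐ t ∂μ, ‖z - t‖ ≤ Real.exp c) (h : shiftedPotential c μ z ≠ ⊤) :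
    μ {z} = 0 ∧ Integrable (fun t => Real.log ‖z - t‖) μ := by
  have hne : ∀ᵐ t ∂μ, t ≠ z := by
    filter_upwards [ae_lt_top (measurable_shiftedKernel_right c z) h] with t ht htz
    rw [htz, shiftedKernel_self] at ht
    exact lt_irrefl _ ht
  refine ⟨measure_eq_zero_iff_ae_notMem.2 hne, ?_⟩
  have h1 : shiftedPotential c μ z = ∫⁻ t, ENNReal.ofReal (c - Real.log ‖z - t‖) ∂μ := by
    refine lintegral_congr_ae ?_
    filter_upwards [hne] with t ht using shiftedKernel_of_ne c ht.symm
  have h2 : Integrable (fun t => c - Real.log ‖z - t‖) μ := by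
    have hm : Measurable fun t => c - Real.log ‖z - t‖ :=
      measurable_const.sub (measurable_log_norm_sub z)
    rw [← lintegral_ofReal_ne_top_iff_integrable hm.aestronglyMeasurable, ← h1]
    · exact h
    · filter_upwards [hne, hc] with t ht htc
      have := (Real.log_le_iff_le_exp (norm_pos_iff.2 (sub_ne_zero.2 ht.symm))).2 htc
      simpa using this
  refine ((integrable_const c).sub h2).congr (Eventually.of_forall fun t => ?_)
  simp

lemma logPotential_eq_realLogPotential (hK : IsCompact K) (hμ : μ ∈ probMeasuresOn K) {z : ℂ}
    (hi : Integrable (fun t => Real.log ‖z - t‖) μ) (hz : μ {z} = 0) :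
    logPotential μ z = realLogPotential μ z := by
  have := hμ.1
  obtain ⟨c, hc, hcK⟩ := exists_norm_sub_le_exp hK (isCompact_singleton (x := z))
  have hcz := hcK z rfl
  have hae : ∀ᵐ t ∂μ, ‖z - t‖ ≤ Real.exp c :=
    (ae_mem_of_mem_probMeasuresOn hμ).mono fun t ht => hcz t ht
  have hne : ∀ᵐ t ∂μ, t ≠ z := measure_eq_zero_iff_ae_notMem.1 hz
  have hnn : 0 ≤ c + realLogPotential μ z := by
    have : ∫ t, Real.log ‖z - t‖ ∂μ ≤ ∫ _, c ∂μ := by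
      refine integral_mono_ae hi (integrable_const c) ?_
      filter_upwards [hne, hae] with t ht htc
      exact (Real.log_le_iff_le_exp (norm_pos_iff.2 (sub_ne_zero.2 ht.symm))).2 htc
    simp only [integral_const, probReal_univ, smul_eq_mul, one_mul] at this
    rw [realLogPotential]; linarith
  rw [logPotential_eq_shiftedPotential_sub hμ hc hcz, shiftedPotential_eq_ofReal hi hz hae,
    EReal.coe_ennreal_ofReal, max_eq_left hnn, ← EReal.coe_sub]
  congr 1; ring

lemma measure_singleton_eq_zero_of_notMem (hμ : μ ∈ probMeasuresOn K) {z : ℂ} (hz : z ∉ K) :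
    μ {z} = 0 :=
  measure_mono_null (by simpa using hz) hμ.2

lemma logPotential_eq_realLogPotential_of_notMem (hK : IsCompact K) (hμ : μ ∈ probMeasuresOn K)
    {z : ℂ} (hz : z ∉ K) : logPotential μ z = realLogPotential μ z :=
  logPotential_eq_realLogPotential hK hμ (integrable_log_norm_sub_of_notMem hK hμ hz)
    (measure_singleton_eq_zero_of_notMem hμ hz)

lemma log_norm_sub_eq {z z₀ t : ℂ} (h0 : z₀ ≠ t) (h1 : z ≠ t) :
    Real.log ‖z - t‖ = Real.log ‖z₀ - t‖ + (Complex.log (1 + (z - z₀) / (z₀ - t))).re := by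
  have h0' : z₀ - t ≠ 0 := sub_ne_zero.2 h0
  have h : z - t = (z₀ - t) * (1 + (z - z₀) / (z₀ - t)) := by field_simp; ring
  have h2 : 1 + (z - z₀) / (z₀ - t) ≠ 0 := fun h' => sub_ne_zero.2 h1 (by rw [h, h', mul_zero])
  rw [Complex.log_re, ← Real.log_mul (norm_ne_zero_iff.2 h0') (norm_ne_zero_iff.2 h2), ← norm_mul,
    ← h]

/-- By `log_norm_sub_eq`, near `z₀` the integrand is a constant in `z` plus the real part of `log (1
+ (z - z₀) / (z₀ - t))`. This is analytic in `z` on a disc independent of `t ∈ K`, so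
differentiation under the integral shows that its integral is analytic. -/
lemma harmonicOnNhd_realLogPotential (hK : IsCompact K) (hμ : μ ∈ probMeasuresOn K) :
    HarmonicOnNhd (realLogPotential μ) Kᶜ := by
  intro z₀ hz₀
  have := hμ.1
  have haeK := ae_mem_of_mem_probMeasuresOn hμ
  obtain ⟨r, hr, hball⟩ := Metric.isOpen_iff.1 hK.isClosed.isOpen_compl z₀ hz₀
  have hdist : ∀ t ∈ K, r ≤ ‖z₀ - t‖ := fun t ht => by
    by_contra! h
    exact hball (by rwa [Metric.mem_ball, dist_comm, dist_eq_norm]) ht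
  have hsmall : ∀ z ∈ Metric.ball z₀ (r / 2), ∀ t ∈ K, ‖(z - z₀) / (z₀ - t)‖ < 1 := by
    intro z hz t ht
    rw [norm_div, div_lt_one (hr.trans_le (hdist t ht))]
    rw [Metric.mem_ball, dist_eq_norm] at hz
    linarith [hdist t ht]
  have hslit : ∀ z ∈ Metric.ball z₀ (r / 2), ∀ t ∈ K,
      1 + (z - z₀) / (z₀ - t) ∈ Complex.slitPlane := fun z hz t ht =>
    Complex.mem_slitPlane_of_norm_lt_one (hsmall z hz t ht)
  have hne : ∀ z ∈ Metric.ball z₀ (r / 2), ∀ t ∈ K, r / 2 ≤ ‖z - t‖ := by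
    intro z hz t ht
    have h1 := norm_sub_le_norm_sub_add_norm_sub z₀ z t
    rw [Metric.mem_ball, dist_comm, dist_eq_norm] at hz
    linarith [hdist t ht]
  set F : ℂ → ℂ → ℂ := fun z t => Complex.log (1 + (z - z₀) / (z₀ - t)) with hF
  have hFm : ∀ z, AEStronglyMeasurable (F z) μ := fun z =>
    (Complex.measurable_log.comp (measurable_const.add (measurable_const.div
      (measurable_const.sub measurable_id)))).aestronglyMeasurable
  have hFc : ∀ z ∈ Metric.ball z₀ (r / 2), Integrable (F z) μ := by
    intro z hz
    have hc : ContinuousOn (F z) K := fun t ht => by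
      have : z₀ - t ≠ 0 := norm_pos_iff.1 (hr.trans_le (hdist t ht))
      have h1 : ContinuousAt (fun t : ℂ => 1 + (z - z₀) / (z₀ - t)) t := by
        fun_prop (disch := assumption)
      exact (h1.clog (hslit z hz t ht)).continuousWithinAt
    obtain ⟨C, hC⟩ := hK.exists_bound_of_continuousOn hc
    exact Integrable.of_bound (hFm z) C (haeK.mono fun t ht => hC t ht)
  have hder : ∀ z ∈ Metric.ball z₀ (r / 2),
      HasDerivAt (fun z => ∫ t, F z t ∂μ) (∫ t, 1 / (z - t) ∂μ) z := by
    intro z hz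
    refine (hasDerivAt_integral_of_dominated_loc_of_deriv_le (F := F)
      (F' := fun z t => 1 / (z - t)) (bound := fun _ => 2 / r)
      (Metric.isOpen_ball.mem_nhds hz) (Eventually.of_forall hFm) (hFc z hz) ?_ ?_
      (integrable_const _) ?_).2
    · exact (measurable_const.div (measurable_const.sub measurable_id)).aestronglyMeasurable
    · filter_upwards [haeK] with t ht w hw
      rw [norm_div, norm_one, div_le_div_iff₀ ((half_pos hr).trans_le (hne w hw t ht)) hr]
      linarith [hne w hw t ht]
    · filter_upwards [haeK] with t ht w hw
      have h1 : z₀ - t ≠ 0 := norm_pos_iff.1 (hr.trans_le (hdist t ht))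
      have h2 : w - t ≠ 0 := norm_pos_iff.1 ((half_pos hr).trans_le (hne w hw t ht))
      have h3 : HasDerivAt (fun w => 1 + (w - z₀) / (z₀ - t)) (1 / (z₀ - t)) w :=
        (((hasDerivAt_id w).sub_const z₀).div_const (z₀ - t)).const_add 1
      have h4 : 1 + (w - z₀) / (z₀ - t) = (w - t) / (z₀ - t) := by field_simp; ring
      have h5 : 1 / (z₀ - t) / (1 + (w - z₀) / (z₀ - t)) = 1 / (w - t) := by
        rw [h4]; field_simp
      exact h5 ▸ h3.clog (hslit w hw t ht)
  have hhalf : Metric.ball z₀ (r / 2) ∈ 𝓝 z₀ := Metric.ball_mem_nhds _ (half_pos hr)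
  have hana : AnalyticAt ℂ (fun z => ∫ t, F z t ∂μ) z₀ :=
    DifferentiableOn.analyticAt (s := Metric.ball z₀ (r / 2))
      (fun z hz => (hder z hz).differentiableAt.differentiableWithinAt) hhalf
  have hharm : HarmonicAt (fun z => realLogPotential μ z₀ - (∫ t, F z t ∂μ).re) z₀ :=
    (InnerProductSpace.harmonicAt_const _).sub hana.harmonicAt_re
  refine (InnerProductSpace.harmonicAt_congr_nhds ?_).1 hharm
  filter_upwards [hhalf] with z hz
  have hre : (∫ t, F z t ∂μ).re = ∫ t, (F z t).re ∂μ :=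
    (integral_re (hFc z hz)).symm
  have hFre : Integrable (fun t => (F z t).re) μ := (hFc z hz).re
  rw [realLogPotential, realLogPotential, hre, ← neg_add', ← integral_add
    (integrable_log_norm_sub_of_notMem hK hμ hz₀) hFre]
  congr 1
  refine integral_congr_ae ?_
  filter_upwards [haeK] with t ht
  exact (log_norm_sub_eq (fun h : z₀ = t => hz₀ (h ▸ ht)) (fun h => by
    have := hne z hz t ht; rw [h] at this; simp at this; linarith)).symm

lemma realLogPotential_add_log_bounds (hK : IsCompact K) (hμ : μ ∈ probMeasuresOn K) {ρ : ℝ}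
    (hρ : K ⊆ Metric.closedBall 0 ρ) {z : ℂ} (hz : ρ < ‖z‖) :
    -Real.log (‖z‖ + ρ) ≤ realLogPotential μ z ∧ realLogPotential μ z ≤ -Real.log (‖z‖ - ρ) := by
  have := hμ.1
  have haeK := ae_mem_of_mem_probMeasuresOn hμ
  have hi := integrable_log_norm_sub_of_notMem hK hμ
    (fun h => absurd (mem_closedBall_zero_iff.1 (hρ h)) hz.not_ge : z ∉ K)
  have h1 : ∀ t ∈ K, ‖z‖ - ρ ≤ ‖z - t‖ ∧ ‖z - t‖ ≤ ‖z‖ + ρ := fun t ht => by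
    have := mem_closedBall_zero_iff.1 (hρ ht)
    constructor
    · linarith [norm_sub_norm_le z t]
    · linarith [norm_sub_le z t]
  have h2 : ∫ t, Real.log ‖z - t‖ ∂μ ≤ ∫ _, Real.log (‖z‖ + ρ) ∂μ := by
    refine integral_mono_ae hi (integrable_const _) (haeK.mono fun t ht => ?_)
    exact Real.log_le_log (by linarith [h1 t ht]) (h1 t ht).2
  have h3 : ∫ _, Real.log (‖z‖ - ρ) ∂μ ≤ ∫ t, Real.log ‖z - t‖ ∂μ := by
    refine integral_mono_ae (integrable_const _) hi (haeK.mono fun t ht => ?_)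
    exact Real.log_le_log (by linarith) (h1 t ht).1
  simp only [integral_const, probReal_univ, smul_eq_mul, one_mul] at h2 h3
  rw [realLogPotential]
  exact ⟨neg_le_neg h2, neg_le_neg h3⟩

lemma tendsto_log_norm_add_sub_log_norm (ρ : ℝ) :
    Tendsto (fun z : ℂ => Real.log (‖z‖ + ρ) - Real.log ‖z‖) (Bornology.cobounded ℂ) (𝓝 0) := by
  have h : Tendsto (fun x : ℝ => Real.log (x + ρ) - Real.log x) atTop (𝓝 0) :=
    Real.tendsto_log_comp_add_sub_log ρ
  exact h.comp tendsto_norm_cobounded_atTop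

lemma tendsto_realLogPotential_add_log (hK : IsCompact K) (hμ : μ ∈ probMeasuresOn K) :
    Tendsto (fun z => realLogPotential μ z + Real.log ‖z‖) (Bornology.cobounded ℂ) (𝓝 0) := by
  obtain ⟨ρ, -, hρ, -⟩ := exists_setOf_lt_norm_subset hK
  have h1 := (tendsto_log_norm_add_sub_log_norm ρ).neg
  have h2 := (tendsto_log_norm_add_sub_log_norm (-ρ)).neg
  rw [neg_zero] at h1 h2
  refine tendsto_of_tendsto_of_tendsto_of_le_of_le' h1 h2 ?_ ?_ <;>
  filter_upwards [tendsto_norm_cobounded_atTop.eventually_gt_atTop ρ] with z hz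
  · linarith [(realLogPotential_add_log_bounds hK hμ hρ hz).1]
  · have := (realLogPotential_add_log_bounds hK hμ hρ hz).2
    rw [sub_eq_add_neg] at this
    linarith

end

/-! ### Frostman's theorem: the equilibrium potential is bounded by the Robin constant -/

/-- Fatou's lemma along the neighbourhood filter, the shifted kernel being nonnegative and
continuous. -/
lemma lowerSemicontinuous_shiftedPotential (c : ℝ) (μ : Measure ℂ) :
    LowerSemicontinuous (shiftedPotential c μ) := by
  intro x y hy
  have h : shiftedPotential c μ x ≤ liminf (fun z => shiftedPotential c μ z) (𝓝 x) := by
    refine le_trans (le_of_eq ?_) (lintegral_liminf_le (u := 𝓝 x)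
      fun z => measurable_shiftedKernel_right c z)
    refine lintegral_congr fun t => (Tendsto.liminf_eq ?_).symm
    have h1 : Continuous fun z : ℂ => shiftedKernel c z t :=
      Continuous.comp (g := fun p : ℂ × ℂ => shiftedKernel c p.1 p.2) (f := fun z : ℂ => (z, t))
        (continuous_shiftedKernel c) (by fun_prop)
    exact h1.tendsto x
  exact eventually_lt_of_lt_liminf (hy.trans_le h)

lemma shiftedPotential_add (c : ℝ) (μ ν : Measure ℂ) (z : ℂ) :
    shiftedPotential c (μ + ν) z = shiftedPotential c μ z + shiftedPotential c ν z :=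
  lintegral_add_measure _ _ _

lemma shiftedPotential_smul (c : ℝ) (p : ENNReal) (μ : Measure ℂ) (z : ℂ) :
    shiftedPotential c (p • μ) z = p * shiftedPotential c μ z := by
  rw [shiftedPotential, lintegral_smul_measure, smul_eq_mul]; rfl

lemma lintegral_shiftedPotential_comm (c : ℝ) (μ ν : Measure ℂ) [SFinite μ] [SFinite ν] :
    ∫⁻ z, shiftedPotential c μ z ∂ν = ∫⁻ z, shiftedPotential c ν z ∂μ := by
  unfold shiftedPotential
  rw [lintegral_lintegral_swap (measurable_shiftedKernel c).aemeasurable]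
  simp_rw [shiftedKernel_comm c]

lemma shiftedEnergy_add_smul (c : ℝ) (p q : ENNReal) (μ ν : Measure ℂ) [SFinite μ] [SFinite ν] :
    shiftedEnergy c (p • μ + q • ν) = p * p * shiftedEnergy c μ
      + 2 * (p * q * ∫⁻ z, shiftedPotential c μ z ∂ν) + q * q * shiftedEnergy c ν := by
  have hm := measurable_shiftedPotential c μ
  have hn := measurable_shiftedPotential c ν
  unfold shiftedEnergy
  simp_rw [shiftedPotential_add, shiftedPotential_smul]
  rw [lintegral_add_measure, lintegral_smul_measure, lintegral_smul_measure,
    lintegral_add_left (hm.const_mul p), lintegral_add_left (hm.const_mul p),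
    lintegral_const_mul _ hm, lintegral_const_mul _ hn, lintegral_const_mul _ hm,
    lintegral_const_mul _ hn, lintegral_shiftedPotential_comm c ν μ]
  simp only [smul_eq_mul]
  ring

/-- The terms `j` cancel; division by `2 s` and `s → 0` leave the first-order condition `a j ≤ x`.
-/
lemma le_of_forall_quadratic {a j x : ℝ} (ha : 0 ≤ a) (hx : 0 ≤ x)
    (h : ∀ s : ℝ, 0 < s → s ≤ 1 →
      j ≤ (1 - s * a) * (1 - s * a) * j + 2 * ((1 - s * a) * s * x) + s * s * j) :
    a * j ≤ x := by
  have hlim : Tendsto (fun s : ℝ => x + s * ((a * a * j + j) / 2)) (𝓝[>] 0) (𝓝 (x + 0 * _)) :=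
    tendsto_const_nhds.add ((tendsto_id.mono_left nhdsWithin_le_nhds).mul_const _)
  rw [zero_mul, add_zero] at hlim
  refine ge_of_tendsto hlim ?_
  filter_upwards [Ioc_mem_nhdsGT (zero_lt_one (α := ℝ))] with s hs
  have h1 := h s hs.1 hs.2
  have h2 : 0 ≤ s * (s * (a * x)) := by have := hs.1; positivity
  have h3 : 0 ≤ s * (2 * x + s * (a * a * j + j) - 2 * (a * j)) := by linarith
  linarith [(mul_nonneg_iff_of_pos_left hs.1).1 h3]

section

variable {K : Set ℂ} {μ : Measure ℂ} {c : ℝ}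

lemma shiftedEnergy_le_of_isEquilibriumMeasure (hμ : IsEquilibriumMeasure K μ) (hc : 0 ≤ c)
    (hcK : ∀ z ∈ K, ∀ t ∈ K, ‖z - t‖ ≤ Real.exp c) {ν : Measure ℂ} (hν : ν ∈ probMeasuresOn K) :
    shiftedEnergy c μ ≤ shiftedEnergy c ν := by
  have h : logEnergy μ ≤ logEnergy ν := hμ.2.trans_le (iInf₂_le ν hν)
  rw [logEnergy_eq_shiftedEnergy_sub hμ.1 hc hcK, logEnergy_eq_shiftedEnergy_sub hν hc hcK] at h
  have h2 := add_le_add_left h (c : EReal)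
  rw [EReal.sub_add_cancel, EReal.sub_add_cancel] at h2
  exact EReal.coe_ennreal_le_coe_ennreal_iff.1 h2

lemma shiftedEnergy_eq_ofReal (hμ : IsEquilibriumMeasure K μ) {V : ℝ} (hV : robinConstant K = V)
    (hc : 0 ≤ c) (hcK : ∀ z ∈ K, ∀ t ∈ K, ‖z - t‖ ≤ Real.exp c) :
    0 ≤ c + V ∧ shiftedEnergy c μ = ENNReal.ofReal (c + V) := by
  have h : ((shiftedEnergy c μ : ENNReal) : EReal) = ((c + V : ℝ) : EReal) := by
    rw [add_comm, EReal.coe_add, ← hV, ← hμ.2, logEnergy_eq_shiftedEnergy_sub hμ.1 hc hcK,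
      EReal.sub_add_cancel]
  have h0 : 0 ≤ c + V := by
    have := EReal.coe_ennreal_nonneg (shiftedEnergy c μ)
    rw [h] at this
    exact_mod_cast this
  refine ⟨h0, ?_⟩
  rw [← EReal.coe_ennreal_eq_coe_ennreal_iff, h, EReal.coe_ennreal_ofReal, max_eq_left h0]

/-- First variation of the energy at the minimizer, along the probability measures `(1 - s μ(A)) μ +
s μ|_A`. The quadratic term is harmless because the energy of `μ|_A` is at most that of `μ`. -/
lemma measure_mul_shiftedEnergy_le (hμ : IsEquilibriumMeasure K μ) (hc : 0 ≤ c)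
    (hcK : ∀ z ∈ K, ∀ t ∈ K, ‖z - t‖ ≤ Real.exp c) (hfin : shiftedEnergy c μ ≠ ⊤)
    {A : Set ℂ} :
    μ A * shiftedEnergy c μ ≤ ∫⁻ z in A, shiftedPotential c μ z ∂μ := by
  have := hμ.1.1
  set J := shiftedEnergy c μ with hJ
  set X := ∫⁻ z in A, shiftedPotential c μ z ∂μ with hX
  have hXJ : X ≤ J := setLIntegral_le_lintegral _ _
  have hXfin : X ≠ ⊤ := ne_top_of_le_ne_top hfin hXJ
  have hYJ : shiftedEnergy c (μ.restrict A) ≤ J :=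
    (setLIntegral_le_lintegral _ _).trans
      (lintegral_mono fun z => lintegral_mono' Measure.restrict_le_self le_rfl)
  have ha1 : (μ A).toReal ≤ 1 := measureReal_le_one
  have hafin : μ A ≠ ⊤ := measure_ne_top μ A
  have key : (μ A).toReal * J.toReal ≤ X.toReal := by
    refine le_of_forall_quadratic ENNReal.toReal_nonneg ENNReal.toReal_nonneg
      fun s hs hs1 => ?_
    have hsa : 0 ≤ 1 - s * (μ A).toReal := by nlinarith [ENNReal.toReal_nonneg (a := μ A)]
    set p := ENNReal.ofReal (1 - s * (μ A).toReal) with hp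
    set q := ENNReal.ofReal s with hq
    have hν : p • μ + q • μ.restrict A ∈ probMeasuresOn K := by
      refine ⟨⟨?_⟩, ?_⟩
      · simp only [Measure.add_apply, Measure.smul_apply, measure_univ, smul_eq_mul, mul_one,
          Measure.restrict_apply_univ]
        rw [← ENNReal.ofReal_toReal hafin, ← ENNReal.ofReal_mul hs.le,
          ← ENNReal.ofReal_add hsa (by positivity)]
        simp
      · have h0 : μ.restrict A Kᶜ = 0 := Measure.restrict_le_self.absolutelyContinuous hμ.1.2
        simp [hμ.1.2, h0]
    have h1 := shiftedEnergy_le_of_isEquilibriumMeasure hμ hc hcK hν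
    rw [shiftedEnergy_add_smul] at h1
    have h2 : J ≤ p * p * J + 2 * (p * q * X) + q * q * J := by
      refine h1.trans ?_
      gcongr
    have hpf : p ≠ ⊤ := ENNReal.ofReal_ne_top
    have hqf : q ≠ ⊤ := ENNReal.ofReal_ne_top
    have h3 := ENNReal.toReal_mono (by finiteness) h2
    rw [ENNReal.toReal_add (by finiteness) (by finiteness),
      ENNReal.toReal_add (by finiteness) (by finiteness)] at h3
    simpa [hp, hq, ENNReal.toReal_ofReal hsa, ENNReal.toReal_ofReal hs.le] using h3
  rw [← ENNReal.toReal_mul] at key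
  exact (ENNReal.toReal_le_toReal (by finiteness) hXfin).1 key

/-- On the complement of `B = {U > J}` the potential has mean at least `J`, by the variational
inequality. If `B` had positive mass, its contribution would push the total energy strictly above
`J`. -/
lemma ae_shiftedPotential_le (hμ : IsEquilibriumMeasure K μ) (hc : 0 ≤ c)
    (hcK : ∀ z ∈ K, ∀ t ∈ K, ‖z - t‖ ≤ Real.exp c) (hfin : shiftedEnergy c μ ≠ ⊤) :
    ∀ᵐ z ∂μ, shiftedPotential c μ z ≤ shiftedEnergy c μ := by
  have := hμ.1.1
  have hm := measurable_shiftedPotential c μ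
  set J := shiftedEnergy c μ with hJ
  set B : Set ℂ := {z | J < shiftedPotential c μ z} with hB
  have hBm : MeasurableSet B := measurableSet_lt measurable_const hm
  have h0 : μ B = 0 := by
    by_contra hne
    have h1 := measure_mul_shiftedEnergy_le (A := Bᶜ) hμ hc hcK hfin
    have h2 : (∫⁻ z in B, shiftedPotential c μ z ∂μ) + ∫⁻ z in Bᶜ, shiftedPotential c μ z ∂μ = J :=
      lintegral_add_compl _ hBm
    have h3 : ∫⁻ _ in B, J ∂μ < ∫⁻ z in B, shiftedPotential c μ z ∂μ :=
      setLIntegral_strict_mono hBm hne hm (by simp; finiteness) (Eventually.of_forall fun z hz => hz)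
    have h4 : μ B * J + μ Bᶜ * J = J := by
      rw [← add_mul, measure_add_measure_compl hBm, measure_univ, one_mul]
    rw [setLIntegral_const, mul_comm] at h3
    have h5 : J < J := by
      conv_lhs => rw [← h4]
      conv_rhs => rw [← h2]
      exact ENNReal.add_lt_add_of_lt_of_le (by finiteness) h3 h1
    exact lt_irrefl _ h5
  filter_upwards [measure_eq_zero_iff_ae_notMem.1 h0] with z hz using not_lt.1 hz

/-- By lower semicontinuity, a point with larger potential has a whole neighbourhood of such points,
and this is a null set by the almost everywhere bound. -/
lemma shiftedPotential_le_of_mem_support (hμ : IsEquilibriumMeasure K μ) (hc : 0 ≤ c)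
    (hcK : ∀ z ∈ K, ∀ t ∈ K, ‖z - t‖ ≤ Real.exp c) (hfin : shiftedEnergy c μ ≠ ⊤) {z : ℂ}
    (hz : z ∈ μ.support) : shiftedPotential c μ z ≤ shiftedEnergy c μ := by
  by_contra! h
  have h1 : {w | shiftedEnergy c μ < shiftedPotential c μ w} ∈ 𝓝 z :=
    lowerSemicontinuous_shiftedPotential c μ z _ h
  have h2 := (Measure.mem_support_iff_forall z).1 hz _ h1
  refine h2.ne' (measure_eq_zero_iff_ae_notMem.2 ?_)
  filter_upwards [ae_shiftedPotential_le hμ hc hcK hfin] with w hw using not_lt.2 hw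

end

/-- Continuity principle for potentials, in the form of an upper bound. -/
lemma eventually_realLogPotential_le {S : Set ℂ} (hS : IsCompact S) {μ : Measure ℂ}
    (hμ : μ ∈ probMeasuresOn S) {V : ℝ} (hV : ∀ z ∈ S, μ {z} = 0 ∧
      Integrable (fun t => Real.log ‖z - t‖) μ ∧ realLogPotential μ z ≤ V) {ζ : ℂ} (hζ : ζ ∈ S)
    {ε : ℝ} (hε : 0 < ε) : ∀ᶠ z in 𝓝[Sᶜ] ζ, realLogPotential μ z ≤ V + ε := by
  have := hμ.1
  have haeS := ae_mem_of_mem_probMeasuresOn hμ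
  -- `π z` is a nearest point of `S` to `z`. Then `|π z - t| ≤ 2 |z - t|` for `t ∈ S`, so moving
  -- from `π z` to `z` raises the integrand of the potential by at most `log 2`.
  choose π hπS hπ using fun z : ℂ => hS.exists_infDist_eq_dist ⟨ζ, hζ⟩ z
  have hπle : ∀ z, ∀ t ∈ S, ‖z - π z‖ ≤ ‖z - t‖ := fun z t ht => by
    rw [← dist_eq_norm, ← dist_eq_norm, ← hπ]; exact Metric.infDist_le_dist_of_mem ht
  have h2 : ∀ z, ∀ t ∈ S, ‖π z - t‖ ≤ 2 * ‖z - t‖ := fun z t ht => by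
    have h1 := norm_sub_le_norm_sub_add_norm_sub (π z) z t
    rw [norm_sub_rev (π z) z] at h1
    linarith [hπle z t ht]
  have hπlim : Tendsto π (𝓝[Sᶜ] ζ) (𝓝 ζ) := by
    rw [tendsto_iff_norm_sub_tendsto_zero]
    have h3 : Tendsto (fun z : ℂ => 2 * ‖z - ζ‖) (𝓝[Sᶜ] ζ) (𝓝 0) := by
      have : Continuous fun z : ℂ => 2 * ‖z - ζ‖ := by fun_prop
      simpa using (this.tendsto ζ).mono_left nhdsWithin_le_nhds
    exact squeeze_zero (fun _ => norm_nonneg _) (fun z => h2 z ζ hζ) h3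
  set H : ℂ → ℂ → ℝ := fun z t => max (Real.log ‖π z - t‖ - Real.log ‖z - t‖) 0 with hH
  have hHm : ∀ z, Measurable (H z) := fun z =>
    ((measurable_log_norm_sub _).sub (measurable_log_norm_sub _)).max measurable_const
  have hHb : ∀ z ∈ Sᶜ, ∀ᵐ t ∂μ, ‖H z t‖ ≤ Real.log 2 := by
    intro z hz
    filter_upwards [haeS, measure_eq_zero_iff_ae_notMem.1 (hV _ (hπS z)).1] with t ht htπ
    have h4 : 0 < ‖z - t‖ := norm_pos_iff.2 (sub_ne_zero.2 fun h : z = t => hz (h ▸ ht))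
    have h5 : 0 < ‖π z - t‖ := norm_pos_iff.2 (sub_ne_zero.2 fun h => htπ h.symm)
    have h6 := Real.log_le_log h5 (h2 z t ht)
    rw [Real.log_mul two_ne_zero h4.ne'] at h6
    rw [Real.norm_eq_abs, abs_of_nonneg (le_max_right _ _)]
    exact max_le (by linarith) (Real.log_nonneg one_le_two)
  have hHi : ∀ z ∈ Sᶜ, Integrable (H z) μ := fun z hz =>
    Integrable.of_bound (hHm z).aestronglyMeasurable _ (hHb z hz)
  -- Dominated convergence with bound `log 2`. The integrand tends to `0` for every `t ≠ ζ`, and `ζ`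
  -- carries no mass.
  have hlim : Tendsto (fun z => ∫ t, H z t ∂μ) (𝓝[Sᶜ] ζ) (𝓝 (∫ _, (0 : ℝ) ∂μ)) := by
    refine tendsto_integral_filter_of_dominated_convergence (fun _ => Real.log 2)
      (Eventually.of_forall fun z => (hHm z).aestronglyMeasurable)
      (eventually_mem_nhdsWithin.mono hHb) (integrable_const _) ?_
    filter_upwards [measure_eq_zero_iff_ae_notMem.1 (hV ζ hζ).1] with t ht
    have hne : ‖ζ - t‖ ≠ 0 := norm_ne_zero_iff.2 (sub_ne_zero.2 fun h => ht h.symm)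
    have h7 : Tendsto (fun z => Real.log ‖π z - t‖) (𝓝[Sᶜ] ζ) (𝓝 (Real.log ‖ζ - t‖)) :=
      ((hπlim.sub_const t).norm).log hne
    have h8 : Tendsto (fun z => Real.log ‖z - t‖) (𝓝[Sᶜ] ζ) (𝓝 (Real.log ‖ζ - t‖)) :=
      (((tendsto_id.mono_left nhdsWithin_le_nhds).sub_const t).norm).log hne
    have h9 := (h7.sub h8).max (tendsto_const_nhds (x := (0 : ℝ)))
    simpa using h9
  rw [integral_zero] at hlim
  filter_upwards [hlim.eventually (gt_mem_nhds hε), eventually_mem_nhdsWithin] with z hz hzS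
  obtain ⟨-, hi, hle⟩ := hV _ (hπS z)
  have hiz := integrable_log_norm_sub_of_notMem hS hμ hzS
  have h10 : ∫ t, (Real.log ‖π z - t‖ - Real.log ‖z - t‖) ∂μ ≤ ∫ t, H z t ∂μ :=
    integral_mono (hi.sub hiz) (hHi z hzS) fun t => le_max_left _ _
  rw [integral_sub hi hiz] at h10
  rw [realLogPotential] at hle ⊢
  linarith

/-- The potential of an equilibrium measure is everywhere at most the Robin constant. -/
theorem realLogPotential_le_robinConstant {K : Set ℂ} (hK : IsCompact K) {μ : Measure ℂ}
    (hμ : IsEquilibriumMeasure K μ) {V : ℝ} (hV : robinConstant K = V) (z : ℂ) :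
    μ {z} = 0 ∧ Integrable (fun t => Real.log ‖z - t‖) μ ∧ realLogPotential μ z ≤ V := by
  have := hμ.1.1
  obtain ⟨c, hc, hcK⟩ := exists_norm_sub_le_exp hK hK
  obtain ⟨hcV, hJ⟩ := shiftedEnergy_eq_ofReal hμ hV hc hcK
  have hfin : shiftedEnergy c μ ≠ ⊤ := hJ ▸ ENNReal.ofReal_ne_top
  have hSK : μ.support ⊆ K := Measure.support_subset_of_isClosed hK.isClosed hμ.1.2
  have hS : IsCompact μ.support := hK.of_isClosed_subset Measure.isClosed_support hSK
  have hμS : μ ∈ probMeasuresOn μ.support := ⟨this, Measure.measure_compl_support⟩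
  have hsupp : ∀ z ∈ μ.support, μ {z} = 0 ∧
      Integrable (fun t => Real.log ‖z - t‖) μ ∧ realLogPotential μ z ≤ V := by
    intro z hz
    have hae : ∀ᵐ t ∂μ, ‖z - t‖ ≤ Real.exp c :=
      (ae_mem_of_mem_probMeasuresOn hμ.1).mono fun t ht => hcK z (hSK hz) t ht
    have hle := shiftedPotential_le_of_mem_support hμ hc hcK hfin hz
    obtain ⟨h1, h2⟩ := integrable_of_shiftedPotential_ne_top hae (ne_top_of_le_ne_top hfin hle)
    refine ⟨h1, h2, ?_⟩
    rw [shiftedPotential_eq_ofReal h2 h1 hae, hJ, ENNReal.ofReal_le_ofReal_iff hcV] at hle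
    linarith
  by_cases hz : z ∈ μ.support
  · exact hsupp z hz
  refine ⟨measure_singleton_eq_zero_of_notMem hμS hz,
    integrable_log_norm_sub_of_notMem hS hμS hz, ?_⟩
  -- Off the support, the bound spreads by the maximum principle: the continuity principle controls
  -- the boundary, and the potential tends to `-∞` at infinity.
  have hmax := InnerProductSpace.HarmonicOnNhd.nonpos_of_boundary (W := μ.supportᶜ)
    (v := fun z => realLogPotential μ z - V) hS.isClosed.isOpen_compl
    ((harmonicOnNhd_realLogPotential hS hμS).sub fun z _ => InnerProductSpace.harmonicAt_const V)
    (fun ζ hζ ε hε => by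
      rw [frontier_compl] at hζ
      filter_upwards [eventually_realLogPotential_le hS hμS hsupp (hS.isClosed.frontier_subset hζ)
        hε] with w hw
      linarith)
    (fun ε hε => by
      refine Eventually.filter_mono inf_le_left ?_
      have h1 := tendsto_realLogPotential_add_log hS hμS
      have h2 := Real.tendsto_log_atTop.comp (tendsto_norm_cobounded_atTop (E := ℂ))
      filter_upwards [h1.eventually (gt_mem_nhds zero_lt_one), h2.eventually_ge_atTop (1 - V)]
        with w hw1 hw2
      simp only [Function.comp_apply] at hw2
      linarith) hz
  simpa using hmax

/-! ### Comparison of Green's functions -/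

/-- Locally `g = Re F` with `F` analytic, so `g ∘ φ = Re (F ∘ φ)`. -/
lemma InnerProductSpace.HarmonicAt.comp_analyticAt {g : ℂ → ℝ} {φ : ℂ → ℂ} {z : ℂ}
    (hg : HarmonicAt g (φ z)) (hφ : AnalyticAt ℂ φ z) : HarmonicAt (fun w => g (φ w)) z := by
  obtain ⟨r, hr, hball⟩ := Metric.eventually_nhds_iff_ball.1 hg.eventually
  obtain ⟨F, hF, hFg⟩ := InnerProductSpace.HarmonicOnNhd.exists_analyticOnNhd_ball_re_eq
    (f := g) (z := φ z) (R := r) hball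
  have h1 : AnalyticAt ℂ (fun w => F (φ w)) z :=
    (hF _ (Metric.mem_ball_self hr)).comp hφ
  refine (InnerProductSpace.harmonicAt_congr_nhds ?_).1 h1.harmonicAt_re
  filter_upwards [hφ.continuousAt (Metric.ball_mem_nhds _ hr)] with w hw using hFg hw

lemma InnerProductSpace.HarmonicAt.const_mul {g : ℂ → ℝ} {z : ℂ} (a : ℝ)
    (hg : HarmonicAt g z) : HarmonicAt (fun w => a * g w) z := by
  simpa [Pi.smul_def] using hg.const_smul (c := a)

lemma tendsto_log_norm_cobounded :
    Tendsto (fun z : ℂ => Real.log ‖z‖) (Bornology.cobounded ℂ) atTop :=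
  Real.tendsto_log_atTop.comp tendsto_norm_cobounded_atTop

/-- Comparison principle for functions with a logarithmic pole at infinity. -/
theorem le_of_boundary_of_log_pole {W : Set ℂ} (hW : IsOpen W) (hWinf : W ∈ Bornology.cobounded ℂ)
    {u g : ℂ → ℝ} (hu : HarmonicOnNhd u W) (hg : HarmonicOnNhd g W) (hg0 : ∀ z ∈ W, 0 ≤ g z)
    (hb : ∀ ζ ∈ frontier W, ∀ δ > 0, ∀ᶠ z in 𝓝[W] ζ, u z - g z ≤ δ) {a b : ℝ}
    (hua : Tendsto (fun z => u z - Real.log ‖z‖) (Bornology.cobounded ℂ) (𝓝 a))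
    (hgb : Tendsto (fun z => g z - Real.log ‖z‖) (Bornology.cobounded ℂ) (𝓝 b)) :
    (∀ z ∈ W, u z ≤ g z) ∧ a ≤ b := by
  have key : ∀ z ∈ W, u z ≤ g z := by
    intro z hz
    -- The factor `1 - ε` makes the difference tend to `-∞` at infinity. On the boundary it costs
    -- nothing, since `(1 - ε) u - g = (1 - ε) (u - g) - ε g` and `g ≥ 0`.
    have h1 : ∀ ε ∈ Set.Ioo (0 : ℝ) 1, (1 - ε) * u z - g z ≤ 0 := by
      intro ε hε
      refine InnerProductSpace.HarmonicOnNhd.nonpos_of_boundary (W := W)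
        (v := fun z => (1 - ε) * u z - g z) hW
        (fun w hw => ((hu w hw).const_mul (1 - ε)).sub (hg w hw)) ?_ ?_ hz
      · intro ζ hζ δ hδ
        filter_upwards [hb ζ hζ δ hδ, eventually_mem_nhdsWithin] with w hw hwW
        nlinarith [hg0 w hwW, hε.1, hε.2]
      · intro δ hδ
        refine Eventually.filter_mono inf_le_left ?_
        have h2 := (hua.eventually (gt_mem_nhds (lt_add_one a)))
        have h3 := (hgb.eventually (lt_mem_nhds (sub_one_lt b)))
        filter_upwards [h2, h3, (tendsto_log_norm_cobounded.const_mul_atTop hε.1).eventually_ge_atTop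
          (|a + 1| - (b - 1))] with w hw2 hw3 hw4
        have h5 : (1 - ε) * (u w - Real.log ‖w‖) ≤ |a + 1| := by
          have h6 : (1 - ε) * (u w - Real.log ‖w‖) ≤ (1 - ε) * |a + 1| :=
            mul_le_mul_of_nonneg_left (hw2.le.trans (le_abs_self _)) (by linarith [hε.2])
          nlinarith [abs_nonneg (a + 1), hε.1]
        linarith
    have hlim : Tendsto (fun ε : ℝ => (1 - ε) * u z - g z) (𝓝[>] 0) (𝓝 ((1 - 0) * u z - g z)) :=
      ((tendsto_const_nhds.sub (tendsto_id.mono_left nhdsWithin_le_nhds)).mul_const _).sub_const _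
    have := le_of_tendsto hlim (by
      filter_upwards [Ioo_mem_nhdsGT (zero_lt_one (α := ℝ))] with ε hε using h1 ε hε)
    linarith
  refine ⟨key, le_of_tendsto_of_tendsto hua hgb ?_⟩
  filter_upwards [hWinf] with z hz
  exact sub_le_sub_right (key z hz) _

/-- The normalized logarithm `log |q(z)| / d` of the monic polynomial `q` with zeros
`x 0, …, x (d - 1)`. -/
def meanLog (x : ℕ → ℂ) (d : ℕ) (z : ℂ) : ℝ :=
  (d : ℝ)⁻¹ * Real.log ‖∏ i ∈ Finset.range d, (z - x i)‖

section meanLog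

variable {x : ℕ → ℂ} {d : ℕ}

lemma prod_sub_ne_zero {z : ℂ} (hz : ∀ i, x i ≠ z) : ∏ i ∈ Finset.range d, (z - x i) ≠ 0 :=
  Finset.prod_ne_zero_iff.2 fun i _ => sub_ne_zero.2 (hz i).symm

lemma harmonicAt_meanLog {z : ℂ} (hz : ∀ i, x i ≠ z) : HarmonicAt (meanLog x d) z := by
  have h : AnalyticAt ℂ (fun z => ∏ i ∈ Finset.range d, (z - x i)) z := by fun_prop
  exact (h.harmonicAt_log_norm (prod_sub_ne_zero hz)).const_mul _

lemma meanLog_le (hd : 1 ≤ d) {z : ℂ} (hz : ∀ i, x i ≠ z) {a : ℝ}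
    (h : ‖∏ i ∈ Finset.range d, (z - x i)‖ ≤ Real.exp (a * d)) : meanLog x d z ≤ a := by
  have hd' : (0 : ℝ) < d := by exact_mod_cast hd
  have h1 := (Real.log_le_iff_le_exp (norm_pos_iff.2 (prod_sub_ne_zero hz))).2 h
  rw [meanLog, inv_mul_le_iff₀ hd']
  linarith

lemma eventually_meanLog_le (hd : 1 ≤ d) {ζ : ℂ} {a : ℝ}
    (h : ∏ i ∈ Finset.range d, ‖ζ - x i‖ ≤ Real.exp (a * d)) {δ : ℝ} (hδ : 0 < δ) :
    ∀ᶠ z in 𝓝 ζ, (∀ i, x i ≠ z) → meanLog x d z ≤ a + δ := by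
  have hd' : (0 : ℝ) < d := by exact_mod_cast hd
  have hc : Continuous fun z : ℂ => ‖∏ i ∈ Finset.range d, (z - x i)‖ := by fun_prop
  have h1 : ‖∏ i ∈ Finset.range d, (ζ - x i)‖ < Real.exp ((a + δ) * d) := by
    rw [norm_prod]
    exact h.trans_lt (Real.exp_lt_exp.2 (by nlinarith))
  filter_upwards [hc.continuousAt.eventually (gt_mem_nhds h1)] with z hz hzx
  exact meanLog_le hd hzx hz.le

lemma tendsto_log_norm_sub_sub_log_norm (a : ℂ) :
    Tendsto (fun z : ℂ => Real.log ‖z - a‖ - Real.log ‖z‖) (Bornology.cobounded ℂ) (𝓝 0) := by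
  refine tendsto_of_tendsto_of_tendsto_of_le_of_le' (tendsto_log_norm_add_sub_log_norm (-‖a‖))
    (tendsto_log_norm_add_sub_log_norm ‖a‖) ?_ ?_ <;>
  filter_upwards [tendsto_norm_cobounded_atTop.eventually_gt_atTop ‖a‖] with z hz
  · gcongr
    · linarith
    · linarith [norm_sub_norm_le z a]
  · gcongr
    · linarith [norm_sub_norm_le z a]
    · exact norm_sub_le z a

lemma tendsto_meanLog_sub_log (hd : 1 ≤ d) :
    Tendsto (fun z => meanLog x d z - Real.log ‖z‖) (Bornology.cobounded ℂ) (𝓝 0) := by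
  have hd' : (d : ℝ) ≠ 0 := by positivity
  have h1 := (tendsto_finsetSum (Finset.range d) fun i _ =>
    tendsto_log_norm_sub_sub_log_norm (x i)).const_mul (d : ℝ)⁻¹
  simp only [Finset.sum_const_zero, mul_zero] at h1
  refine h1.congr' ?_
  have hne : ∀ᶠ z in Bornology.cobounded ℂ, ∀ i ∈ Finset.range d, ‖z - x i‖ ≠ 0 := by
    rw [eventually_all_finset]
    intro i _
    filter_upwards [tendsto_norm_cobounded_atTop.eventually_gt_atTop ‖x i‖] with z hz h
    rw [norm_eq_zero, sub_eq_zero] at h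
    exact hz.ne' (by rw [h])
  filter_upwards [hne] with z hz
  rw [meanLog, norm_prod, Real.log_prod hz, Finset.sum_sub_distrib]
  simp only [Finset.sum_const, Finset.card_range, nsmul_eq_mul]
  field_simp

end meanLog

section

variable {K : Set ℂ} {μ : Measure ℂ} {V : ℝ}

lemma harmonicOnNhd_sub_realLogPotential (hK : IsCompact K) (hμ : μ ∈ probMeasuresOn K) (V : ℝ) :
    HarmonicOnNhd (fun z => V - realLogPotential μ z) Kᶜ := fun z hz =>
  (InnerProductSpace.harmonicAt_const V).sub (harmonicOnNhd_realLogPotential hK hμ z hz)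

lemma tendsto_sub_realLogPotential_sub_log (hK : IsCompact K) (hμ : μ ∈ probMeasuresOn K) (V : ℝ) :
    Tendsto (fun z => V - realLogPotential μ z - Real.log ‖z‖) (Bornology.cobounded ℂ) (𝓝 V) := by
  have := (tendsto_realLogPotential_add_log hK hμ).const_sub V
  simpa [sub_sub] using this

end

lemma tendsto_cobounded_of_isEquivalent {φ : ℂ → ℂ} {A : ℂ} {n : ℕ} (hA : A ≠ 0) (hn : 1 ≤ n)
    (h : Asymptotics.IsEquivalent (Bornology.cobounded ℂ) φ fun z => A * z ^ n) :
    Tendsto φ (Bornology.cobounded ℂ) (Bornology.cobounded ℂ) ∧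
    Tendsto (fun z => Real.log ‖φ z‖ - n * Real.log ‖z‖) (Bornology.cobounded ℂ)
      (𝓝 (Real.log ‖A‖)) := by
  have hz0 : ∀ᶠ z in Bornology.cobounded ℂ, z ≠ (0 : ℂ) := by
    filter_upwards [tendsto_norm_cobounded_atTop.eventually_gt_atTop 0] with z hz
      using norm_pos_iff.1 hz
  have h1 : Tendsto (fun z => ‖φ z / (A * z ^ n)‖) (Bornology.cobounded ℂ) (𝓝 1) := by
    have := (Asymptotics.isEquivalent_iff_tendsto_one (hz0.mono fun z hz =>
      mul_ne_zero hA (pow_ne_zero n hz))).1 h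
    simpa using this.norm
  have hlog : Tendsto (fun z => Real.log ‖φ z‖ - n * Real.log ‖z‖) (Bornology.cobounded ℂ)
      (𝓝 (Real.log ‖A‖)) := by
    have h2 := (h1.log one_ne_zero).add_const (Real.log ‖A‖)
    rw [Real.log_one, zero_add] at h2
    refine h2.congr' ?_
    filter_upwards [hz0, h1.eventually (lt_mem_nhds zero_lt_one)] with z hz hpos
    have hφ : ‖φ z‖ ≠ 0 := fun h0 => by simp [norm_eq_zero.1 h0] at hpos
    rw [norm_div, norm_mul, norm_pow, Real.log_div hφ (by positivity),
      Real.log_mul (norm_ne_zero_iff.2 hA) (by positivity), Real.log_pow]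
    ring
  refine ⟨?_, hlog⟩
  rw [← tendsto_norm_atTop_iff_cobounded]
  have h3 : Tendsto (fun z : ℂ => ‖A‖ * ‖z‖ ^ n * ‖φ z / (A * z ^ n)‖) (Bornology.cobounded ℂ)
      atTop :=
    (((tendsto_pow_atTop (by omega)).comp tendsto_norm_cobounded_atTop).const_mul_atTop
      (norm_pos_iff.2 hA)).atTop_mul_pos one_pos h1
  refine h3.congr' ?_
  filter_upwards [hz0] with z hz
  rw [norm_div, norm_mul, norm_pow]
  have : ‖z‖ ≠ 0 := norm_ne_zero_iff.2 hz
  have : ‖A‖ ≠ 0 := norm_ne_zero_iff.2 hA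
  field_simp

/-- Asymptotics at infinity of a Green's function composed with a map `φ(z) ∼ A z ^ n`. -/
lemma tendsto_comp_sub_log {g : ℂ → ℝ} {V : ℝ}
    (hg : Tendsto (fun z => g z - Real.log ‖z‖) (Bornology.cobounded ℂ) (𝓝 V))
    {φ : ℂ → ℂ} {A : ℂ} {n : ℕ} (hA : A ≠ 0) (hn : 1 ≤ n)
    (h : Asymptotics.IsEquivalent (Bornology.cobounded ℂ) φ fun z => A * z ^ n) :
    Tendsto (fun z => 1 / (n : ℝ) * g (φ z) - Real.log ‖z‖) (Bornology.cobounded ℂ)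
      (𝓝 (1 / (n : ℝ) * (V + Real.log ‖A‖))) := by
  obtain ⟨h1, h2⟩ := tendsto_cobounded_of_isEquivalent hA hn h
  have hn' : (n : ℝ) ≠ 0 := by positivity
  refine (((hg.comp h1).add h2).const_mul (1 / (n : ℝ))).congr fun z => ?_
  simp only [Function.comp_apply]
  field_simp
  ring

/-- The basic inequality for the transformation of capacities, for a holomorphic map defined
on an open set whose finite boundary points either lie in `K₁` or are poles. -/
theorem mul_le_of_lt_robinConstant {K₁ K₂ : Set ℂ} (hK₁ : IsCompact K₁) (hne₁ : K₁.Nonempty)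
    (hK₂ : IsCompact K₂) (hne₂ : K₂.Nonempty) {W : Set ℂ} (hW : IsOpen W)
    (hWinf : W ∈ Bornology.cobounded ℂ) (hWK : W ⊆ K₁ᶜ) {φ : ℂ → ℂ} (hφ : AnalyticOnNhd ℂ φ W)
    (hmaps : Set.MapsTo φ W K₂ᶜ)
    (hb : ∀ ζ ∈ frontier W, ζ ∈ K₁ ∨ Tendsto φ (𝓝[W] ζ) (Bornology.cobounded ℂ))
    {A : ℂ} {n : ℕ} (hA : A ≠ 0) (hn : 1 ≤ n)
    (h : Asymptotics.IsEquivalent (Bornology.cobounded ℂ) φ fun z => A * z ^ n)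
    {V₁ V₂ : ℝ} (hV₁ : (V₁ : EReal) < robinConstant K₁) (hV₂ : robinConstant K₂ = V₂) :
    V₁ ≤ 1 / (n : ℝ) * (V₂ + Real.log ‖A‖) := by
  obtain ⟨μ, hμ⟩ := exists_isEquilibriumMeasure hK₂ hne₂
  obtain ⟨d, x, hd, hxK, hx⟩ := exists_prod_norm_sub_le hK₁ hne₁ hV₁
  have hn' : (0 : ℝ) < 1 / (n : ℝ) := by positivity
  have hxW : ∀ z ∈ W, ∀ i, x i ≠ z := fun z hz i hi => hWK hz (hi ▸ hxK i)
  set g : ℂ → ℝ := fun z => V₂ - realLogPotential μ z with hg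
  have hg0 : ∀ z, 0 ≤ g z := fun z => sub_nonneg.2 (realLogPotential_le_robinConstant hK₂ hμ hV₂ z).2.2
  have hginf := tendsto_sub_realLogPotential_sub_log hK₂ hμ.1 V₂
  have hinf : Tendsto (fun z => meanLog x d z + V₁ - Real.log ‖z‖) (Bornology.cobounded ℂ)
      (𝓝 V₁) := by
    have := (tendsto_meanLog_sub_log (x := x) hd).add_const V₁
    rw [zero_add] at this
    exact this.congr fun z => by ring
  refine (le_of_boundary_of_log_pole (u := fun z => meanLog x d z + V₁)
    (g := fun z => 1 / (n : ℝ) * g (φ z)) hW hWinf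
    (fun z hz => (harmonicAt_meanLog (hxW z hz)).add (InnerProductSpace.harmonicAt_const V₁))
    (fun z hz => ((harmonicOnNhd_sub_realLogPotential hK₂ hμ.1 V₂ _ (hmaps hz)).comp_analyticAt
      (hφ z hz)).const_mul _)
    (fun z _ => mul_nonneg hn'.le (hg0 _)) ?_ hinf (tendsto_comp_sub_log hginf hA hn h)).2
  -- At a point of `K₁` the polynomial bound gives an upper limit at most `0`, and `g ≥ 0`. At a
  -- pole of `φ` the function `g ∘ φ` tends to `+∞` while the polynomial term stays bounded above.
  intro ζ hζ δ hδ
  rcases hb ζ hζ with hζK | hpole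
  · filter_upwards [nhdsWithin_le_nhds (eventually_meanLog_le hd (hx ζ hζK) hδ),
      eventually_mem_nhdsWithin] with z hz hzW
    have := hz (hxW z hzW)
    nlinarith [hg0 (φ z), mul_nonneg hn'.le (hg0 (φ z))]
  · obtain ⟨a, ha⟩ : ∃ a : ℝ, ∏ i ∈ Finset.range d, ‖ζ - x i‖ ≤ Real.exp (a * d) := by
      -- Any upper bound suffices at a pole: for `p ≥ 0` and `d ≥ 1`, `p ≤ exp (p d)`.
      refine ⟨∏ i ∈ Finset.range d, ‖ζ - x i‖, ?_⟩
      have hp : 0 ≤ ∏ i ∈ Finset.range d, ‖ζ - x i‖ := Finset.prod_nonneg fun _ _ => norm_nonneg _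
      have hd' : (1 : ℝ) ≤ d := by exact_mod_cast hd
      nlinarith [Real.add_one_le_exp ((∏ i ∈ Finset.range d, ‖ζ - x i‖) * d)]
    have hgtop : Tendsto (fun z => 1 / (n : ℝ) * g (φ z)) (𝓝[W] ζ) atTop := by
      have h1 : Tendsto g (Bornology.cobounded ℂ) atTop := by
        simpa [hg] using hginf.add_atTop tendsto_log_norm_cobounded
      exact (h1.comp hpole).const_mul_atTop hn'
    filter_upwards [nhdsWithin_le_nhds (eventually_meanLog_le hd ha one_pos),
      eventually_mem_nhdsWithin, hgtop.eventually_ge_atTop (a + 1 + V₁)] with z hz hzW hgz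
    have := hz (hxW z hzW)
    linarith

/-! ### Uniqueness of the Green's function of a regular domain -/

section

variable {K : Set ℂ}

lemma IsGreenFunction.tendsto_atTop {g : ℂ → ℝ} (hg : IsGreenFunction K g) :
    Tendsto g (Bornology.cobounded ℂ) atTop := by
  obtain ⟨C, hC⟩ := hg.atInfinity.bound
  refine tendsto_atTop_mono' _ ?_ (tendsto_atTop_add_const_right _ (-C) tendsto_log_norm_cobounded)
  filter_upwards [hC] with z hz
  simp only [norm_one, mul_one, Real.norm_eq_abs] at hz
  linarith [neg_le_of_abs_le hz]

lemma IsGreenFunction.exists_abs_sub_le {g g' : ℂ → ℝ} (hg : IsGreenFunction K g)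
    (hg' : IsGreenFunction K g') : ∃ B : ℝ, 0 < B ∧ ∀ z ∈ outerDomain K, |g' z - g z| ≤ B := by
  obtain ⟨C, hC⟩ := hg.atInfinity.bound
  obtain ⟨C', hC'⟩ := hg'.atInfinity.bound
  obtain ⟨R, -, hR⟩ := (hasBasis_cobounded_norm (E := ℂ)).eventually_iff.1 (hC.and hC')
  obtain ⟨M, hM⟩ := hg.bounded R
  obtain ⟨M', hM'⟩ := hg'.bounded R
  refine ⟨|C| + |C'| + |M| + |M'| + 1, by positivity, fun z hz => ?_⟩
  have h1 := le_abs_self C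
  have h2 := le_abs_self C'
  have h3 := le_abs_self M
  have h4 := le_abs_self M'
  have h5 := abs_nonneg C
  have h6 := abs_nonneg C'
  have h7 := abs_nonneg M
  have h8 := abs_nonneg M'
  rcases le_total ‖z‖ R with h | h
  · have := abs_sub (g' z) (g z)
    linarith [hM z hz h, hM' z hz h]
  · obtain ⟨h9, h10⟩ := hR h
    simp only [norm_one, mul_one, Real.norm_eq_abs] at h9 h10
    have h11 := abs_sub (g' z - Real.log ‖z‖) (g z - Real.log ‖z‖)
    rw [sub_sub_sub_cancel_right] at h11
    linarith

/-- Since `g` vanishes at every boundary point and tends to `+∞` at infinity, the ordinary maximum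
principle applied to `-g` suffices. -/
lemma IsGreenFunction.nonneg (hK : IsCompact K) {g : ℂ → ℝ} (hg : IsGreenFunction K g)
    (hg0 : ∀ ζ ∈ frontier (outerDomain K), Tendsto g (𝓝[outerDomain K] ζ) (𝓝 0)) {z : ℂ}
    (hz : z ∈ outerDomain K) : 0 ≤ g z := by
  have := InnerProductSpace.HarmonicOnNhd.nonpos_of_boundary (v := -g) (isOpen_outerDomain hK)
    hg.harmonic.neg
    (fun ζ hζ ε hε => by
      filter_upwards [(hg0 ζ hζ).eventually (lt_mem_nhds (neg_lt_zero.2 hε))] with w hw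
      simp only [Pi.neg_apply]; linarith)
    (fun ε hε => by
      refine Eventually.filter_mono inf_le_left ?_
      filter_upwards [hg.tendsto_atTop.eventually_ge_atTop 0] with w hw
      simp only [Pi.neg_apply]; linarith) hz
  simpa using this

/-- Extended maximum principle: a bounded harmonic function on `Ω_K` which vanishes at quasi-almost
every boundary point is nonpositive, provided `Ω_K` has a Green's function that vanishes at every
boundary point. -/
lemma nonpos_of_quasiAlmostEverywhere (hK : IsCompact K) (hne : K.Nonempty) {g : ℂ → ℝ}
    (hg : IsGreenFunction K g)
    (hg0 : ∀ ζ ∈ frontier (outerDomain K), Tendsto g (𝓝[outerDomain K] ζ) (𝓝 0))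
    {k : ℂ → ℝ} (hk : HarmonicOnNhd k (outerDomain K)) {B : ℝ} (hB : 0 < B)
    (hkB : ∀ z ∈ outerDomain K, k z ≤ B)
    (hq : QuasiAlmostEverywhere (frontier (outerDomain K))
      fun ζ => Tendsto k (𝓝[outerDomain K] ζ) (𝓝 0)) {z : ℂ} (hz : z ∈ outerDomain K) :
    k z ≤ 0 := by
  refine le_of_forall_pos_le_add fun ε hε => ?_
  rw [zero_add]
  set Ω := outerDomain K with hΩ
  have hgnn : ∀ w ∈ Ω, 0 ≤ g w := fun w hw => hg.nonneg hK hg0 hw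
  -- `E` consists of the boundary points approached through `k ≥ ε`. It is compact and contained in
  -- the exceptional set, so it has capacity zero; at every other boundary point `k < ε` nearby.
  set E : Set ℂ := frontier Ω ∩ closure {w | w ∈ Ω ∧ ε ≤ k w} with hE
  have hEK : E ⊆ K := fun ζ hζ => frontier_outerDomain_subset hK hζ.1
  have hEc : IsCompact E := hK.of_isClosed_subset (isClosed_frontier.inter isClosed_closure) hEK
  have hE0 : robinConstant E = ⊤ := by
    obtain ⟨S, -, hS, hS'⟩ := hq
    refine robinConstant_eq_top hEc (hS E (fun ζ hζ => ?_) hEc)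
    by_contra hζS
    have h1 := (hS' ζ ⟨hζ.1, hζS⟩).eventually (gt_mem_nhds hε)
    have hnb : (𝓝[{w | w ∈ Ω ∧ ε ≤ k w}] ζ).NeBot := mem_closure_iff_nhdsWithin_neBot.1 hζ.2
    have h2 : ∀ᶠ w in 𝓝[{w | w ∈ Ω ∧ ε ≤ k w}] ζ, k w < ε :=
      nhdsWithin_mono _ (fun w hw => hw.1) h1
    obtain ⟨w, hw1, hw2⟩ := (h2.and eventually_mem_nhdsWithin).exists
    exact absurd hw1 hw2.2.not_gt
  have hpoly : ∀ M : ℝ, ∃ (d : ℕ) (x : ℕ → ℂ), 1 ≤ d ∧ (∀ i, x i ∈ K) ∧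
      ∀ ζ ∈ E, ∏ i ∈ Finset.range d, ‖ζ - x i‖ ≤ Real.exp (-M * d) := fun M => by
    rcases E.eq_empty_or_nonempty with h | h
    · obtain ⟨t, ht⟩ := hne
      exact ⟨1, fun _ => t, le_rfl, fun _ => ht, by simp [h]⟩
    · obtain ⟨d, x, hd, hx, hle⟩ := exists_prod_norm_sub_le hEc h (V := M)
        (by rw [hE0]; exact EReal.coe_lt_top M)
      exact ⟨d, x, hd, fun i => hEK (hx i), hle⟩
  obtain ⟨c, hc, hcK⟩ := exists_norm_sub_le_exp hK hK
  -- A lower bound for `meanLog x d z` at the fixed point `z`, valid for all polynomials with zeros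
  -- in `K`, hence independent of `m` below.
  obtain ⟨r, hrK⟩ : ∃ r : ℝ, ∀ t ∈ K, Real.exp r ≤ ‖z - t‖ := by
    have hpos : 0 < Metric.infDist z K :=
      (hK.isClosed.notMem_iff_infDist_pos hne).1 (outerDomain_subset_compl hz)
    refine ⟨Real.log (Metric.infDist z K), fun t ht => ?_⟩
    rw [Real.exp_log hpos, ← dist_eq_norm]
    exact Metric.infDist_le_dist_of_mem ht
  -- The barrier is `2 g - log |q| / d + (c + 1)`, where `log |q| / d ≤ -(m + 1)` on `E`. It is at
  -- least `m` near `E` and nonnegative near the rest of the boundary. The coefficient `2` makes it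
  -- grow like `log |z|` at infinity, one multiple of `g` being absorbed by `log |q| / d`. Scaled by
  -- `B / m`, it dominates `k - ε`, and its value at `z` tends to `0` as `m → ∞`.
  have key : ∀ m : ℝ, 0 < m → k z ≤ ε + m⁻¹ * (B * (-r + 2 * g z + (c + 1))) := by
    intro m hm
    obtain ⟨d, x, hd, hxK, hxE⟩ := hpoly (m + 1)
    have hxΩ : ∀ w ∈ Ω, ∀ i, x i ≠ w := fun w hw i hi =>
      outerDomain_subset_compl hw (hi ▸ hxK i)
    have hη : 0 < m⁻¹ * B := by positivity
    have hmax := InnerProductSpace.HarmonicOnNhd.nonpos_of_boundary (W := Ω)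
      (v := fun w => k w - ε - m⁻¹ * B * (2 * g w - meanLog x d w + (c + 1)))
      (isOpen_outerDomain hK)
      (fun w hw => ((hk w hw).sub (InnerProductSpace.harmonicAt_const ε)).sub
        (((((hg.harmonic w hw).const_mul 2).sub (harmonicAt_meanLog (hxΩ w hw))).add
          (InnerProductSpace.harmonicAt_const (c + 1))).const_mul (m⁻¹ * B))) ?_ ?_ hz
    · have h1 : r ≤ meanLog x d z := by
        have hd' : (0 : ℝ) < d := by exact_mod_cast hd
        have h2 : ∀ i ∈ Finset.range d, r ≤ Real.log ‖z - x i‖ := fun i _ =>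
          (Real.le_log_iff_exp_le ((Real.exp_pos r).trans_le (hrK _ (hxK i)))).2 (hrK _ (hxK i))
        rw [meanLog, norm_prod, Real.log_prod fun i _ =>
          ((Real.exp_pos r).trans_le (hrK _ (hxK i))).ne', le_inv_mul_iff₀ hd']
        simpa using Finset.card_nsmul_le_sum _ _ _ h2
      have h3 : m⁻¹ * B * (2 * g z - meanLog x d z + (c + 1))
          ≤ m⁻¹ * B * (-r + 2 * g z + (c + 1)) := mul_le_mul_of_nonneg_left (by linarith) hη.le
      linarith
    · intro ζ hζ δ hδ
      have hζK := frontier_outerDomain_subset hK hζ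
      by_cases hζE : ζ ∈ closure {w | w ∈ Ω ∧ ε ≤ k w}
      · filter_upwards [nhdsWithin_le_nhds (eventually_meanLog_le hd (hxE ζ ⟨hζ, hζE⟩) one_pos),
          eventually_mem_nhdsWithin] with w hw hwΩ
        have h1 := hw (hxΩ w hwΩ)
        have h2 : m⁻¹ * B * m ≤ m⁻¹ * B * (2 * g w - meanLog x d w + (c + 1)) :=
          mul_le_mul_of_nonneg_left (by linarith [hgnn w hwΩ]) hη.le
        have h3 : m⁻¹ * B * m = B := by field_simp
        linarith [hkB w hwΩ]
      · have hle : ∏ i ∈ Finset.range d, ‖ζ - x i‖ ≤ Real.exp (c * d) := by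
          refine (Finset.prod_le_prod (fun i _ => norm_nonneg _)
            fun i _ => hcK ζ hζK _ (hxK i)).trans ?_
          rw [Finset.prod_const, Finset.card_range, ← Real.exp_nat_mul, mul_comm]
        filter_upwards [nhdsWithin_le_nhds (eventually_meanLog_le hd hle one_pos),
          eventually_mem_nhdsWithin,
          nhdsWithin_le_nhds (isClosed_closure.isOpen_compl.mem_nhds hζE)] with w hw hwΩ hwk
        have h1 := hw (hxΩ w hwΩ)
        have h2 : k w < ε := by
          by_contra! h
          exact hwk (subset_closure ⟨hwΩ, h⟩)
        have h3 : 0 ≤ m⁻¹ * B * (2 * g w - meanLog x d w + (c + 1)) :=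
          mul_nonneg hη.le (by linarith [hgnn w hwΩ])
        linarith
    · intro δ hδ
      obtain ⟨C, hC⟩ := hg.atInfinity.bound
      have h1 := (tendsto_meanLog_sub_log (x := x) hd).eventually (gt_mem_nhds one_pos)
      filter_upwards [mem_inf_of_left hC, mem_inf_of_left h1, mem_inf_of_right (mem_principal_self Ω),
        mem_inf_of_left (tendsto_log_norm_cobounded.eventually_ge_atTop (2 * C + 1 + m))]
        with w hw1 hw2 hwΩ hw3
      simp only [norm_one, mul_one, Real.norm_eq_abs] at hw1 hw2 hw3
      have h4 := neg_le_of_abs_le hw1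
      have h2 : m⁻¹ * B * m ≤ m⁻¹ * B * (2 * g w - meanLog x d w + (c + 1)) :=
        mul_le_mul_of_nonneg_left (by linarith) hη.le
      have h3 : m⁻¹ * B * m = B := by field_simp
      linarith [hkB w hwΩ]
  have hlim : Tendsto (fun m : ℝ => ε + m⁻¹ * (B * (-r + 2 * g z + (c + 1)))) atTop
      (𝓝 (ε + 0 * (B * (-r + 2 * g z + (c + 1))))) :=
    tendsto_const_nhds.add (tendsto_inv_atTop_zero.mul_const _)
  rw [zero_mul, add_zero] at hlim
  refine ge_of_tendsto hlim ?_
  filter_upwards [eventually_gt_atTop 0] with m hm using key m hm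

lemma QuasiAlmostEverywhere.mono {E : Set ℂ} {P Q : ℂ → Prop} (h : QuasiAlmostEverywhere E P)
    (hPQ : ∀ ζ ∈ E, P ζ → Q ζ) : QuasiAlmostEverywhere E Q := by
  obtain ⟨S, hS, hS', hP⟩ := h
  exact ⟨S, hS, hS', fun ζ hζ => hPQ ζ hζ.1 (hP ζ hζ)⟩

/-- The logarithmic poles cancel, so `g' - g` and `g - g'` are bounded and the extended maximum
principle applies to both. -/
theorem IsGreenFunction.eq_of_tendsto (hK : IsCompact K) (hne : K.Nonempty) {g g' : ℂ → ℝ}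
    (hg : IsGreenFunction K g)
    (hg0 : ∀ ζ ∈ frontier (outerDomain K), Tendsto g (𝓝[outerDomain K] ζ) (𝓝 0))
    (hg' : IsGreenFunction K g') {z : ℂ} (hz : z ∈ outerDomain K) : g' z = g z := by
  obtain ⟨B, hB, hle⟩ := hg.exists_abs_sub_le hg'
  have h1 := nonpos_of_quasiAlmostEverywhere hK hne hg hg0 (k := fun w => g' w - g w)
    (fun w hw => (hg'.harmonic w hw).sub (hg.harmonic w hw)) hB
    (fun w hw => (le_abs_self _).trans (hle w hw))
    (hg'.boundary.mono fun ζ hζ h => by simpa using h.sub (hg0 ζ hζ)) hz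
  have h2 := nonpos_of_quasiAlmostEverywhere hK hne hg hg0 (k := fun w => g w - g' w)
    (fun w hw => (hg.harmonic w hw).sub (hg'.harmonic w hw)) hB
    (fun w hw => by rw [← neg_sub]; exact (neg_le_abs _).trans (hle w hw))
    (hg'.boundary.mono fun ζ hζ h => by simpa using (hg0 ζ hζ).sub h) hz
  linarith

theorem greenFunction_eq_of_tendsto (hK : IsCompact K) (hne : K.Nonempty) {g : ℂ → ℝ}
    (hg : IsGreenFunction K g)
    (hg0 : ∀ ζ ∈ frontier (outerDomain K), Tendsto g (𝓝[outerDomain K] ζ) (𝓝 0)) {z : ℂ}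
    (hz : z ∈ outerDomain K) : greenFunction K z = g z :=
  hg.eq_of_tendsto hK hne hg0 (Classical.epsilon_spec ⟨g, hg⟩) hz

lemma logCapacity_empty : logCapacity ∅ = 0 := by
  refine logCapacity_of_robinConstant_eq_top (iInf₂_eq_top.2 fun μ hμ => ?_)
  have h1 := hμ.2
  have := hμ.1
  rw [Set.compl_empty, measure_univ] at h1
  exact absurd h1 one_ne_zero

lemma quasiAlmostEverywhere_of_forall {E : Set ℂ} {P : ℂ → Prop} (h : ∀ ζ ∈ E, P ζ) :
    QuasiAlmostEverywhere E P := by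
  refine ⟨∅, MeasurableSet.empty, fun C hC _ => ?_, fun ζ hζ => h ζ hζ.1⟩
  rw [Set.subset_empty_iff.1 hC, logCapacity_empty]

/-- A function `g` harmonic on `Ω_K`, with the boundary behaviour of a Green's function and
`g(z) = log |z| + b + o(1)` at infinity, where `b` is at least the Robin constant `V`, equals
`V - U^μ` for any equilibrium measure `μ`. -/
theorem eq_sub_realLogPotential (hK : IsCompact K) {μ : Measure ℂ}
    (hμ : IsEquilibriumMeasure K μ) {V : ℝ} (hV : robinConstant K = V) {g : ℂ → ℝ} {b : ℝ}
    (hg : HarmonicOnNhd g (outerDomain K))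
    (hg0 : ∀ ζ ∈ frontier (outerDomain K), Tendsto g (𝓝[outerDomain K] ζ) (𝓝 0))
    (hgb : Tendsto (fun z => g z - Real.log ‖z‖) (Bornology.cobounded ℂ) (𝓝 b)) (hVb : V ≤ b) :
    b = V ∧ ∀ z ∈ outerDomain K, V - realLogPotential μ z = g z := by
  set Ω := outerDomain K with hΩ
  have hΩo : IsOpen Ω := isOpen_outerDomain hK
  set h : ℂ → ℝ := fun z => V - realLogPotential μ z with hh
  have hhΩ : HarmonicOnNhd h Ω :=
    (harmonicOnNhd_sub_realLogPotential hK hμ.1 V).mono outerDomain_subset_compl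
  have hh0 : ∀ z, 0 ≤ h z := fun z => sub_nonneg.2 (realLogPotential_le_robinConstant hK hμ hV z).2.2
  have hhinf := tendsto_sub_realLogPotential_sub_log hK hμ.1 V
  -- Only `h ≥ 0` is known about the boundary behaviour of `h = V - U^μ`; this is enough for `g ≤ h`
  -- because `g` vanishes on the boundary.
  obtain ⟨hle, hbV⟩ := le_of_boundary_of_log_pole hΩo (outerDomain_mem_cobounded hK) hg hhΩ
    (fun z _ => hh0 z) (fun ζ hζ δ hδ => by
      filter_upwards [(hg0 ζ hζ).eventually (gt_mem_nhds hδ)] with w hw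
      linarith [hh0 w]) hgb hhinf
  have hb : b = V := le_antisymm hbV hVb
  refine ⟨hb, fun z hz => ?_⟩
  set k : ℂ → ℝ := fun z => h z - g z with hk
  have hkΩ : HarmonicOnNhd k Ω := fun w hw => (hhΩ w hw).sub (hg w hw)
  have hk0 : ∀ w ∈ Ω, 0 ≤ k w := fun w hw => sub_nonneg.2 (hle w hw)
  have hkinf : Tendsto k (Bornology.cobounded ℂ) (𝓝 0) := by
    have := hhinf.sub hgb
    rw [hb, sub_self] at this
    refine this.congr fun w => ?_
    simp only [hk, hh]; ring
  -- The zero of `k` at infinity has to be turned into a finite one. If `k` had none, it would be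
  -- bounded below near infinity by its positive minimum on a circle, contradicting `k → 0`.
  suffices ∃ p ∈ Ω, k p = 0 by
    obtain ⟨p, hp, hp0⟩ := this
    have := InnerProductSpace.HarmonicOnNhd.eq_zero_of_nonneg hΩo (isPreconnected_outerDomain hK)
      hkΩ hk0 hp hp0 hz
    simp only [hk] at this
    linarith
  by_contra! hcon
  obtain ⟨ρ, hρ, -, hρK⟩ := exists_setOf_lt_norm_subset hK
  have hρΩ := setOf_lt_norm_subset_outerDomain hρ hρK
  set R := ρ + 1 with hR
  have hRpos : 0 < R := by linarith
  have hsph : Metric.sphere (0 : ℂ) R ⊆ Ω := fun w hw => hρΩ (by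
    rw [mem_sphere_zero_iff_norm] at hw
    change ρ < ‖w‖
    linarith)
  have hextΩ : {w : ℂ | R < ‖w‖} ⊆ Ω := fun w (hw : R < ‖w‖) => hρΩ (by
    change ρ < ‖w‖
    linarith)
  obtain ⟨p, hp, hmin⟩ := (isCompact_sphere (0 : ℂ) R).exists_isMinOn
    (NormedSpace.sphere_nonempty.2 hRpos.le) (hkΩ.continuousOn.mono hsph)
  have hδ : 0 < k p := lt_of_le_of_ne (hk0 p (hsph hp)) (hcon p (hsph hp)).symm
  have hext : ∀ w : ℂ, R < ‖w‖ → k p ≤ k w := by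
    intro w hw
    -- The term `ε log (|w| / R)` vanishes on the circle and handles infinity in the maximum
    -- principle; then `ε → 0`.
    have h1 : ∀ ε > 0, k p - ε * (Real.log ‖w‖ - Real.log R) - k w ≤ 0 := by
      intro ε hε
      refine InnerProductSpace.HarmonicOnNhd.nonpos_of_boundary (W := {w : ℂ | R < ‖w‖})
        (v := fun w => k p - ε * (Real.log ‖w‖ - Real.log R) - k w)
        (isOpen_lt continuous_const continuous_norm) ?_ ?_ ?_ hw
      · intro y hy
        have hy0 : y ≠ 0 := norm_pos_iff.1 (hRpos.trans hy)
        exact ((InnerProductSpace.harmonicAt_const (k p)).sub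
          (((analyticAt_id.harmonicAt_log_norm hy0).sub
            (InnerProductSpace.harmonicAt_const (Real.log R))).const_mul ε)).sub
          (hkΩ y (hextΩ hy))
      · intro ζ hζ δ hδ'
        have hζR : R = ‖ζ‖ := frontier_lt_subset_eq continuous_const continuous_norm hζ
        have hζS : ζ ∈ Metric.sphere (0 : ℂ) R := mem_sphere_zero_iff_norm.2 hζR.symm
        have hc : ContinuousAt k ζ :=
          hkΩ.continuousOn.continuousAt (hΩo.mem_nhds (hsph hζS))
        have hpζ : k p ≤ k ζ := hmin hζS
        have h2 : k p - δ < k ζ := by linarith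
        filter_upwards [nhdsWithin_le_nhds (hc.eventually (lt_mem_nhds h2)),
          eventually_mem_nhdsWithin] with y hy (hyR : R < ‖y‖)
        have h3 := Real.log_le_log hRpos hyR.le
        nlinarith
      · intro δ hδ'
        filter_upwards [mem_inf_of_left (((tendsto_log_norm_cobounded.atTop_add
            (tendsto_const_nhds (x := -Real.log R))).const_mul_atTop hε).eventually_ge_atTop (k p)),
          mem_inf_of_right (mem_principal_self _)] with y hy hyR
        have h4 := hk0 y (hextΩ hyR)
        rw [← sub_eq_add_neg] at hy
        linarith
    have hlim : Tendsto (fun ε : ℝ => k p - ε * (Real.log ‖w‖ - Real.log R) - k w) (𝓝[>] 0)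
        (𝓝 (k p - 0 * (Real.log ‖w‖ - Real.log R) - k w)) :=
      (tendsto_const_nhds.sub ((tendsto_id.mono_left nhdsWithin_le_nhds).mul_const _)).sub_const _
    have := le_of_tendsto hlim (eventually_mem_nhdsWithin.mono fun ε hε => h1 ε hε)
    linarith
  obtain ⟨w, hw1, hw2⟩ := ((hkinf.eventually (gt_mem_nhds hδ)).and
    (tendsto_norm_cobounded_atTop.eventually_gt_atTop R)).exists
  exact absurd (hext w hw2) hw1.not_ge

end

/-! ### Regularity and Green's functions in terms of equilibrium potentials -/

section

variable {K : Set ℂ}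

lemma logPotential_eq_of_mem_outerDomain (hK : IsCompact K) {μ : Measure ℂ}
    (hμ : μ ∈ probMeasuresOn K) {z : ℂ} (hz : z ∈ outerDomain K) :
    logPotential μ z = realLogPotential μ z :=
  logPotential_eq_realLogPotential_of_notMem hK hμ (outerDomain_subset_compl hz)

lemma isRegularOuterDomain_iff (hK : IsCompact K) (hne : K.Nonempty) {V : ℝ}
    (hV : robinConstant K = V) :
    IsRegularOuterDomain K ↔ ∀ ζ ∈ frontier (outerDomain K),
      Tendsto (fun z => V - realLogPotential (equilibriumMeasure K) z) (𝓝[outerDomain K] ζ)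
        (𝓝 0) := by
  have hμ := isEquilibriumMeasure_equilibriumMeasure hK hne
  refine forall₂_congr fun ζ _ => ?_
  have h1 : Tendsto (logPotential (equilibriumMeasure K)) (𝓝[outerDomain K] ζ)
      (𝓝 (robinConstant K)) ↔
      Tendsto (realLogPotential (equilibriumMeasure K)) (𝓝[outerDomain K] ζ) (𝓝 V) := by
    rw [hV, ← EReal.tendsto_coe]
    exact tendsto_congr' (eventually_mem_nhdsWithin.mono fun z hz =>
      logPotential_eq_of_mem_outerDomain hK hμ.1 hz)
  rw [h1]
  constructor
  · intro h
    simpa using h.const_sub V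
  · intro h
    simpa using h.const_sub V

lemma isGreenFunction_sub_realLogPotential (hK : IsCompact K) {μ : Measure ℂ}
    (hμ : IsEquilibriumMeasure K μ) {V : ℝ} (hV : robinConstant K = V)
    (h0 : ∀ ζ ∈ frontier (outerDomain K),
      Tendsto (fun z => V - realLogPotential μ z) (𝓝[outerDomain K] ζ) (𝓝 0)) :
    IsGreenFunction K fun z => V - realLogPotential μ z where
  harmonic := (harmonicOnNhd_sub_realLogPotential hK hμ.1 V).mono outerDomain_subset_compl
  bounded R := by
    have := hμ.1.1
    obtain ⟨c, -, hc⟩ := exists_norm_sub_le_exp hK (isCompact_closedBall (0 : ℂ) R)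
    refine ⟨V + c, fun z hz hzR => ?_⟩
    have hzK := outerDomain_subset_compl hz
    rw [abs_of_nonneg (sub_nonneg.2 (realLogPotential_le_robinConstant hK hμ hV z).2.2),
      realLogPotential, sub_neg_eq_add]
    gcongr
    have h1 : ∫ t, Real.log ‖z - t‖ ∂μ ≤ ∫ _, c ∂μ := by
      refine integral_mono_ae (integrable_log_norm_sub_of_notMem hK hμ.1 hzK) (integrable_const c) ?_
      filter_upwards [ae_mem_of_mem_probMeasuresOn hμ.1] with t ht
      exact (Real.log_le_iff_le_exp (norm_pos_iff.2 (sub_ne_zero.2 fun h : z = t =>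
        hzK (h ▸ ht)))).2 (hc z (by simpa using hzR) t ht)
    simpa using h1
  atInfinity := (tendsto_sub_realLogPotential_sub_log hK hμ.1 V).isBigO_one ℝ
  boundary := quasiAlmostEverywhere_of_forall h0

lemma greenFunction_eq_sub_realLogPotential (hK : IsCompact K) (hne : K.Nonempty)
    {μ : Measure ℂ} (hμ : IsEquilibriumMeasure K μ) {V : ℝ} (hV : robinConstant K = V)
    (h0 : ∀ ζ ∈ frontier (outerDomain K),
      Tendsto (fun z => V - realLogPotential μ z) (𝓝[outerDomain K] ζ) (𝓝 0)) {z : ℂ}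
    (hz : z ∈ outerDomain K) : greenFunction K z = V - realLogPotential μ z :=
  greenFunction_eq_of_tendsto hK hne (isGreenFunction_sub_realLogPotential hK hμ hV h0) h0 hz

lemma logCapacity_nonneg (K : Set ℂ) : 0 ≤ logCapacity K := ENNReal.toReal_nonneg

lemma norm_mul_exp_neg_pow {A : ℂ} (hA : A ≠ 0) (V : ℝ) (n : ℕ) :
    ‖A‖ * Real.exp (-V) ^ n = Real.exp (Real.log ‖A‖ - n * V) := by
  rw [sub_eq_add_neg, Real.exp_add, Real.exp_log (norm_pos_iff.2 hA), ← Real.exp_nat_mul]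
  congr 2; ring

end

/-- The inequality of capacities, for a holomorphic map defined on an open set whose finite
boundary points either lie in `K₁` or are poles. -/
theorem robinConstant_le_of_isEquivalent {K₁ K₂ : Set ℂ} (hK₁ : IsCompact K₁)
    (hne₁ : K₁.Nonempty) (hK₂ : IsCompact K₂) (hne₂ : K₂.Nonempty) {W : Set ℂ} (hW : IsOpen W)
    (hWinf : W ∈ Bornology.cobounded ℂ) (hWK : W ⊆ K₁ᶜ) {φ : ℂ → ℂ} (hφ : AnalyticOnNhd ℂ φ W)
    (hmaps : Set.MapsTo φ W K₂ᶜ)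
    (hb : ∀ ζ ∈ frontier W, ζ ∈ K₁ ∨ Tendsto φ (𝓝[W] ζ) (Bornology.cobounded ℂ))
    {A : ℂ} {n : ℕ} (hA : A ≠ 0) (hn : 1 ≤ n)
    (h : Asymptotics.IsEquivalent (Bornology.cobounded ℂ) φ fun z => A * z ^ n)
    {V₂ : ℝ} (hV₂ : robinConstant K₂ = V₂) :
    ∃ V₁ : ℝ, robinConstant K₁ = V₁ ∧ V₁ ≤ 1 / (n : ℝ) * (V₂ + Real.log ‖A‖) := by
  -- Letting `V₁` increase to the Robin constant of `K₁` also proves that the latter is finite.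
  have key : robinConstant K₁ ≤ ((1 / (n : ℝ) * (V₂ + Real.log ‖A‖) : ℝ) : EReal) := by
    refine EReal.ge_of_forall_gt_iff_ge.1 fun V₁ hV₁ => ?_
    rw [EReal.coe_le_coe_iff]
    exact mul_le_of_lt_robinConstant hK₁ hne₁ hK₂ hne₂ hW hWinf hWK hφ hmaps hb hA hn h hV₁ hV₂
  rcases robinConstant_eq_top_or_coe hK₁ with h1 | ⟨V₁, hV₁⟩
  · rw [h1, top_le_iff] at key
    exact absurd key (EReal.coe_ne_top _)
  · exact ⟨V₁, hV₁, by rwa [hV₁, EReal.coe_le_coe_iff] at key⟩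

theorem logCapacity_le_of_isEquivalent {K₁ K₂ : Set ℂ} (hK₁ : IsCompact K₁)
    (hne₁ : K₁.Nonempty) (hK₂ : IsCompact K₂) (hne₂ : K₂.Nonempty) {W : Set ℂ} (hW : IsOpen W)
    (hWinf : W ∈ Bornology.cobounded ℂ) (hWK : W ⊆ K₁ᶜ) {φ : ℂ → ℂ} (hφ : AnalyticOnNhd ℂ φ W)
    (hmaps : Set.MapsTo φ W K₂ᶜ)
    (hb : ∀ ζ ∈ frontier W, ζ ∈ K₁ ∨ Tendsto φ (𝓝[W] ζ) (Bornology.cobounded ℂ))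
    {A : ℂ} {n : ℕ} (hA : A ≠ 0) (hn : 1 ≤ n)
    (h : Asymptotics.IsEquivalent (Bornology.cobounded ℂ) φ fun z => A * z ^ n) :
    logCapacity K₂ ≤ ‖A‖ * logCapacity K₁ ^ n := by
  rcases robinConstant_eq_top_or_coe hK₂ with h2 | ⟨V₂, hV₂⟩
  · rw [logCapacity_of_robinConstant_eq_top h2]
    exact mul_nonneg (norm_nonneg _) (pow_nonneg (logCapacity_nonneg _) _)
  obtain ⟨V₁, hV₁, hle⟩ := robinConstant_le_of_isEquivalent hK₁ hne₁ hK₂ hne₂ hW hWinf hWK hφ hmaps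
    hb hA hn h hV₂
  rw [logCapacity_of_robinConstant_eq hV₁, logCapacity_of_robinConstant_eq hV₂,
    norm_mul_exp_neg_pow hA, Real.exp_le_exp]
  have hn' : (0 : ℝ) < n := by exact_mod_cast hn
  rw [one_div, le_inv_mul_iff₀ hn'] at hle
  linarith

/-! ### Preimages under polynomials -/

lemma logEnergy_le_of_realLogPotential_le {K : Set ℂ} (hK : IsCompact K) {ν : Measure ℂ}
    (hν : ν ∈ probMeasuresOn K) {Y : ℝ} (h : ∀ z ∈ K, ν {z} = 0 ∧
      Integrable (fun t => Real.log ‖z - t‖) ν ∧ realLogPotential ν z ≤ Y) : logEnergy ν ≤ Y := by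
  have := hν.1
  obtain ⟨c₀, hc₀, hc₀K⟩ := exists_norm_sub_le_exp hK hK
  obtain ⟨c, hc, hcY, hcK⟩ : ∃ c : ℝ, 0 ≤ c ∧ 0 ≤ c + Y ∧ ∀ z ∈ K, ∀ t ∈ K, ‖z - t‖ ≤ Real.exp c :=
    ⟨c₀ + |Y|, by positivity, by linarith [neg_abs_le Y], fun z hz t ht =>
      (hc₀K z hz t ht).trans (Real.exp_le_exp.2 (by linarith [abs_nonneg Y]))⟩
  have hae := ae_mem_of_mem_probMeasuresOn hν
  have h1 : shiftedEnergy c ν ≤ ENNReal.ofReal (c + Y) := by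
    refine (lintegral_mono_ae (g := fun _ => ENNReal.ofReal (c + Y)) ?_).trans (by simp)
    filter_upwards [hae] with z hz
    obtain ⟨hz0, hi, hle⟩ := h z hz
    rw [shiftedPotential_eq_ofReal hi hz0 (hae.mono fun t ht => hcK z hz t ht)]
    exact ENNReal.ofReal_le_ofReal (by linarith)
  rw [logEnergy_eq_shiftedEnergy_sub hν hc hcK]
  refine (EReal.sub_le_sub (EReal.coe_ennreal_le_coe_ennreal_iff.2 h1) le_rfl).trans ?_
  rw [EReal.coe_ennreal_ofReal, max_eq_left hcY, ← EReal.coe_sub, EReal.coe_le_coe_iff]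
  linarith

/-- Since `μ` has no atoms, the logarithm of the product splits almost everywhere, despite `Real.log
0 = 0` at the roots. Each factor then contributes minus the potential at a root, which is at least
`-V`. -/
lemma integrable_log_norm_multiset_prod {μ : Measure ℂ} [IsProbabilityMeasure μ] {V : ℝ}
    (h : ∀ z, μ {z} = 0 ∧ Integrable (fun t => Real.log ‖z - t‖) μ ∧ realLogPotential μ z ≤ V)
    (s : Multiset ℂ) :
    Integrable (fun t => Real.log ‖(s.map fun r => t - r).prod‖) μ ∧
      -(Multiset.card s * V) ≤ ∫ t, Real.log ‖(s.map fun r => t - r).prod‖ ∂μ := by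
  have : NullSingletonClass μ := ⟨fun z => (h z).1⟩
  induction s using Multiset.induction_on with
  | empty => simp
  | cons r s ih =>
    have hae : (fun t => Real.log ‖r - t‖ + Real.log ‖(s.map fun r => t - r).prod‖) =ᵐ[μ]
        fun t => Real.log ‖((r ::ₘ s).map fun r => t - r).prod‖ := by
      have hnull : μ (((r ::ₘ s).toFinset : Finset ℂ) : Set ℂ) = 0 :=
        ((r ::ₘ s).toFinset.finite_toSet).measure_zero μ
      filter_upwards [measure_eq_zero_iff_ae_notMem.1 hnull] with t ht
      simp only [Finset.mem_coe, Multiset.mem_toFinset, Multiset.mem_cons, not_or] at ht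
      have h1 : t - r ≠ 0 := sub_ne_zero.2 ht.1
      have h2 : (s.map fun r => t - r).prod ≠ 0 := by
        refine Multiset.prod_ne_zero fun h0 => ?_
        obtain ⟨q, hq, hq0⟩ := Multiset.mem_map.1 h0
        exact ht.2 (sub_eq_zero.1 hq0 ▸ hq)
      rw [Multiset.map_cons, Multiset.prod_cons, norm_mul,
        Real.log_mul (norm_ne_zero_iff.2 h1) (norm_ne_zero_iff.2 h2), norm_sub_rev]
    refine ⟨((h r).2.1.add ih.1).congr hae, ?_⟩
    rw [← integral_congr_ae hae, integral_add (h r).2.1 ih.1, Multiset.card_cons]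
    have h3 := (h r).2.2
    rw [realLogPotential] at h3
    push_cast
    linarith [ih.2]

section Polynomial

variable {P : Polynomial ℂ}

/-- `P(z) / z ^ n` is the reversed polynomial at `1 / z`, and its value at `0` is the leading
coefficient. -/
lemma Polynomial.isEquivalent_cobounded_lead (hP : 1 ≤ P.natDegree) :
    Asymptotics.IsEquivalent (Bornology.cobounded ℂ) (fun z => P.eval z)
      fun z => P.leadingCoeff * z ^ P.natDegree := by
  have hP0 : P.leadingCoeff ≠ 0 := by
    rw [Ne, Polynomial.leadingCoeff_eq_zero]
    rintro rfl
    simp at hP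
  have hz0 : ∀ᶠ z in Bornology.cobounded ℂ, z ≠ (0 : ℂ) := by
    filter_upwards [tendsto_norm_cobounded_atTop.eventually_gt_atTop 0] with z hz
      using norm_pos_iff.1 hz
  rw [Asymptotics.isEquivalent_iff_tendsto_one (hz0.mono fun z hz =>
      mul_ne_zero hP0 (pow_ne_zero _ hz))]
  have h1 : Tendsto (fun z : ℂ => P.reverse.eval z⁻¹ / P.leadingCoeff) (Bornology.cobounded ℂ)
      (𝓝 1) := by
    have h2 := ((P.reverse.continuous.tendsto 0).comp (tendsto_inv₀_cobounded (α := ℂ))).div_const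
      P.leadingCoeff
    rwa [← Polynomial.coeff_zero_eq_eval_zero, Polynomial.coeff_zero_reverse, div_self hP0] at h2
  refine h1.congr' ?_
  filter_upwards [hz0] with z hz
  have h3 : P.reverse.eval z⁻¹ * z ^ P.natDegree = P.eval z := by
    have := invertibleOfNonzero hz
    have h4 := Polynomial.eval₂_reverse_mul_pow (RingHom.id ℂ) z P
    rwa [invOf_eq_inv] at h4
  rw [Pi.div_apply, ← h3]
  field_simp

lemma Polynomial.surjective_eval (hP : 1 ≤ P.natDegree) (y : ℂ) : ∃ w, P.eval w = y := by
  obtain ⟨w, hw⟩ := IsAlgClosed.exists_root (P - Polynomial.C y) (by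
    rw [Polynomial.degree_sub_C (Polynomial.natDegree_pos_iff_degree_pos.1 hP)]
    exact (Polynomial.natDegree_pos_iff_degree_pos.1 hP).ne')
  exact ⟨w, by simpa [sub_eq_zero] using hw⟩

/-- Factoring `P - y = a ∏ (t - r)` turns the potential of the image measure at `y` into `-log |a|`
plus the sum of the potentials of `μ` at the roots, counted with multiplicity. -/
lemma realLogPotential_map_eval_le (hP : 1 ≤ P.natDegree) {μ : Measure ℂ} [IsProbabilityMeasure μ]
    {V : ℝ} (h : ∀ z, μ {z} = 0 ∧ Integrable (fun t => Real.log ‖z - t‖) μ ∧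
      realLogPotential μ z ≤ V) (y : ℂ) :
    (μ.map fun z => P.eval z) {y} = 0 ∧
      Integrable (fun t => Real.log ‖y - t‖) (μ.map fun z => P.eval z) ∧
      realLogPotential (μ.map fun z => P.eval z) y ≤
        P.natDegree * V - Real.log ‖P.leadingCoeff‖ := by
  have : NullSingletonClass μ := ⟨fun z => (h z).1⟩
  have hm : Measurable fun z => P.eval z := P.continuous.measurable
  set Q := P - Polynomial.C y with hQ
  have hdeg := Polynomial.natDegree_pos_iff_degree_pos.1 hP
  have hQd : Q.natDegree = P.natDegree := Polynomial.natDegree_sub_C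
  have hQl : Q.leadingCoeff = P.leadingCoeff := Polynomial.leadingCoeff_sub_of_degree_lt (by
    exact Polynomial.degree_C_le.trans_lt hdeg)
  have hQ0 : Q ≠ 0 := by
    intro h0
    rw [h0, Polynomial.natDegree_zero] at hQd
    omega
  have hl0 : P.leadingCoeff ≠ 0 := hQl ▸ Polynomial.leadingCoeff_ne_zero.2 hQ0
  have heval : ∀ t, P.eval t - y = P.leadingCoeff * (Q.roots.map fun r => t - r).prod := by
    intro t
    have h1 := (IsAlgClosed.splits Q).eval_eq_prod_roots t
    rw [← hQl, ← h1]
    simp [hQ]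
  have hcard : Multiset.card Q.roots = P.natDegree := by
    rw [← hQd]; exact (IsAlgClosed.splits Q).natDegree_eq_card_roots.symm
  obtain ⟨hi, hle⟩ := integrable_log_norm_multiset_prod h Q.roots
  have hnull : μ {t | P.eval t = y} = 0 := by
    refine ((Q.roots.toFinset.finite_toSet).subset fun t ht => ?_).measure_zero μ
    have ht' : P.eval t = y := ht
    rw [Finset.mem_coe, Multiset.mem_toFinset, Polynomial.mem_roots hQ0]
    simp [hQ, ht']
  have hae : (fun t => Real.log ‖P.leadingCoeff‖ + Real.log ‖(Q.roots.map fun r => t - r).prod‖)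
      =ᵐ[μ] fun t => Real.log ‖y - P.eval t‖ := by
    filter_upwards [measure_eq_zero_iff_ae_notMem.1 hnull] with t ht
    have h1 : P.eval t - y ≠ 0 := sub_ne_zero.2 ht
    rw [heval t] at h1
    rw [norm_sub_rev, heval t, norm_mul, Real.log_mul (norm_ne_zero_iff.2 hl0)
      (norm_ne_zero_iff.2 (right_ne_zero_of_mul h1))]
  refine ⟨by rw [Measure.map_apply hm (measurableSet_singleton y)]; exact hnull, ?_, ?_⟩
  · rw [integrable_map_measure (measurable_log_norm_sub y).aestronglyMeasurable hm.aemeasurable]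
    exact ((integrable_const _).add hi).congr hae
  · rw [realLogPotential, integral_map hm.aemeasurable
      (measurable_log_norm_sub y).aestronglyMeasurable, ← integral_congr_ae hae,
      integral_add (integrable_const _) hi]
    rw [hcard] at hle
    simp only [integral_const, probReal_univ, smul_eq_mul, one_mul]
    linarith

/-- The capacity of the preimage of a compact set under a polynomial. -/
theorem logCapacity_preimage_eval (hP : 1 ≤ P.natDegree) {K : Set ℂ} (hK : IsCompact K) :
    ‖P.leadingCoeff‖ * logCapacity ((fun z => P.eval z) ⁻¹' K) ^ P.natDegree = logCapacity K := by
  have hdeg := Polynomial.natDegree_pos_iff_degree_pos.1 hP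
  have hl0 : P.leadingCoeff ≠ 0 := by
    rw [Ne, Polynomial.leadingCoeff_eq_zero]
    rintro rfl
    simp at hP
  rcases K.eq_empty_or_nonempty with rfl | hne
  · rw [Set.preimage_empty, logCapacity_empty, zero_pow (by omega), mul_zero]
  set K₁ := (fun z => P.eval z) ⁻¹' K with hK₁def
  have hK₁ : IsCompact K₁ := (P.isProperMap_eval hdeg).isCompact_preimage hK
  have hne₁ : K₁.Nonempty := by
    obtain ⟨y, hy⟩ := hne
    obtain ⟨w, hw⟩ := Polynomial.surjective_eval hP y
    exact ⟨w, by simpa [hK₁def, hw] using hy⟩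
  -- The whole complement of the preimage serves as `W`, bounded components included: the polynomial
  -- has no finite poles and the frontier lies in `K₁`.
  have hle : logCapacity K ≤ ‖P.leadingCoeff‖ * logCapacity K₁ ^ P.natDegree := by
    refine logCapacity_le_of_isEquivalent (W := K₁ᶜ) hK₁ hne₁ hK hne hK₁.isClosed.isOpen_compl
      (Bornology.isBounded_def.1 hK₁.isBounded) subset_rfl
      (φ := fun z => P.eval z) ?_ (fun z hz => hz)
      (fun ζ hζ => Or.inl ?_) hl0 hP (Polynomial.isEquivalent_cobounded_lead hP)
    · exact fun z _ => P.differentiable.analyticAt z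
    · rw [frontier_compl] at hζ
      exact hK₁.isClosed.frontier_subset hζ
  refine le_antisymm ?_ hle
  rcases robinConstant_eq_top_or_coe hK₁ with h1 | ⟨V₁, hV₁⟩
  · rw [logCapacity_of_robinConstant_eq_top h1, zero_pow (by omega), mul_zero]
    exact logCapacity_nonneg K
  obtain ⟨μ, hμ⟩ := exists_isEquilibriumMeasure hK₁ hne₁
  have := hμ.1.1
  have hm : Measurable fun z => P.eval z := P.continuous.measurable
  have hν : μ.map (fun z => P.eval z) ∈ probMeasuresOn K := by
    refine ⟨Measure.isProbabilityMeasure_map hm.aemeasurable, ?_⟩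
    rw [Measure.map_apply hm hK.measurableSet.compl]
    exact hμ.1.2
  -- The image of the equilibrium measure of `K₁` is a competitor in the energy problem on `K`.
  have hrob : robinConstant K ≤
      ((P.natDegree * V₁ - Real.log ‖P.leadingCoeff‖ : ℝ) : EReal) :=
    (iInf₂_le _ hν).trans (logEnergy_le_of_realLogPotential_le hK hν fun z _ =>
      realLogPotential_map_eval_le hP (realLogPotential_le_robinConstant hK₁ hμ hV₁) z)
  rcases robinConstant_eq_top_or_coe hK with h2 | ⟨V₂, hV₂⟩
  · rw [h2, top_le_iff] at hrob
    exact absurd hrob (EReal.coe_ne_top _)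
  rw [hV₂, EReal.coe_le_coe_iff] at hrob
  rw [logCapacity_of_robinConstant_eq hV₁, logCapacity_of_robinConstant_eq hV₂,
    norm_mul_exp_neg_pow hl0, Real.exp_le_exp]
  linarith

end Polynomial

/-! ### Holomorphic maps of the Riemann sphere fixing infinity -/

@[simp] lemma affineCoord_infty : affineCoord ∞ = 0 := rfl

@[simp] lemma affineCoord_coe (z : ℂ) : affineCoord z = z := rfl

lemma sphereCoord_infty (q : OnePoint ℂ) : sphereCoord ∞ q = (affineCoord q)⁻¹ := by
  induction q using OnePoint.rec with
  | infty => exact (inv_zero (G₀ := ℂ)).symm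
  | coe z => rfl

lemma coe_affineCoord {q : OnePoint ℂ} (hq : q ≠ ∞) : (affineCoord q : OnePoint ℂ) = q := by
  induction q using OnePoint.rec with
  | infty => exact absurd rfl hq
  | coe z => rfl

lemma affineCoord_eq_zero_iff {q : OnePoint ℂ} :
    affineCoord q = 0 ↔ q = ∞ ∨ q = ((0 : ℂ) : OnePoint ℂ) := by
  induction q using OnePoint.rec with
  | infty => simp
  | coe z => simp

section

variable {f : OnePoint ℂ → OnePoint ℂ}

lemma SphereHolomorphicAt.continuousAt_coe {z : ℂ} (hf : SphereHolomorphicAt f z) :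
    ContinuousAt (fun w : ℂ => f w) z :=
  ContinuousAt.comp (g := f) (f := fun w : ℂ => (w : OnePoint ℂ)) hf.1
    OnePoint.continuous_coe.continuousAt

lemma SphereHolomorphicAt.analyticAt_affineCoord {z : ℂ} (hf : SphereHolomorphicAt f z)
    (hz : f z ≠ ∞) : AnalyticAt ℂ (fun w : ℂ => affineCoord (f w)) z := by
  have h := hf.2
  rw [← coe_affineCoord hz] at h
  exact h

lemma SphereHolomorphicAt.analyticAt_inv_affineCoord {z : ℂ} (hf : SphereHolomorphicAt f z)
    (hz : f z = ∞) : AnalyticAt ℂ (fun w : ℂ => (affineCoord (f w))⁻¹) z := by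
  have h := hf.2
  rw [hz] at h
  simp_rw [sphereCoord_infty] at h
  exact h

/-- The inverse coordinate is `0` at `∞`, but also at the point `0`, as `0⁻¹ = 0`; convergence to
`∞` rules out the second case. -/
lemma eventually_eq_infty_of_inv_eq_zero {X : Type*} {l : Filter X} {F : X → OnePoint ℂ}
    (hF : Tendsto F l (𝓝 ∞)) (h : ∀ᶠ x in l, (affineCoord (F x))⁻¹ = 0) :
    ∀ᶠ x in l, F x = ∞ := by
  have h0 : ({((0 : ℂ) : OnePoint ℂ)}ᶜ : Set (OnePoint ℂ)) ∈ 𝓝 ∞ :=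
    isOpen_compl_singleton.mem_nhds (by simp)
  filter_upwards [h, hF h0] with x hx hx0
  rw [inv_eq_zero, affineCoord_eq_zero_iff] at hx
  exact hx.resolve_right hx0

lemma tendsto_coe_cobounded_infty :
    Tendsto (fun z : ℂ => (z : OnePoint ℂ)) (Bornology.cobounded ℂ) (𝓝 ∞) := by
  rw [Metric.cobounded_eq_cocompact, ← coclosedCompact_eq_cocompact]
  exact OnePoint.tendsto_coe_infty

lemma tendsto_cobounded_of_tendsto_infty {l : Filter ℂ} (hl : ∀ᶠ z : ℂ in l, f z ≠ ∞)
    (h : Tendsto (fun z : ℂ => f z) l (𝓝 ∞)) :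
    Tendsto (fun z : ℂ => affineCoord (f z)) l (Bornology.cobounded ℂ) := by
  rw [Metric.cobounded_eq_cocompact, ← coclosedCompact_eq_cocompact, ← OnePoint.comap_coe_nhds_infty,
    tendsto_comap_iff]
  exact h.congr' (hl.mono fun z hz => (coe_affineCoord hz).symm)

variable {K : Set ℂ}

lemma coe_mem_outerSphereDomain {z : ℂ} :
    (z : OnePoint ℂ) ∈ outerSphereDomain K ↔ z ∈ outerDomain K := by
  simp [outerSphereDomain]

lemma infty_mem_outerSphereDomain : ∞ ∈ outerSphereDomain K := Set.mem_insert _ _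

/-- Identity theorem: a holomorphic map which equals `∞` near `∞` equals `∞` throughout. -/
lemma eq_infty_of_eventually_eq_infty (hK : IsCompact K)
    (hf : ∀ p ∈ outerSphereDomain K, SphereHolomorphicAt f p)
    (h : ∀ᶠ z : ℂ in Bornology.cobounded ℂ, f z = ∞) {z : ℂ} (hz : z ∈ outerDomain K) :
    f z = ∞ := by
  set S : Set ℂ := {z | ∀ᶠ w : ℂ in 𝓝 z, f w = ∞} with hS
  have hSo : IsOpen S := isOpen_iff_mem_nhds.2 fun w hw => hw.eventually_nhds
  have hSne : (outerDomain K ∩ S).Nonempty := by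
    obtain ⟨R, -, hR⟩ := (hasBasis_cobounded_norm (E := ℂ)).eventually_iff.1 h
    obtain ⟨w, hw, hwR⟩ := ((eventually_of_mem (outerDomain_mem_cobounded hK) fun _ h => h).and
      (tendsto_norm_cobounded_atTop.eventually_gt_atTop R)).exists
    refine ⟨w, hw, ?_⟩
    filter_upwards [continuous_norm.continuousAt.eventually (lt_mem_nhds hwR)] with y hy
      using hR hy.le
  refine ((isPreconnected_outerDomain hK).subset_of_closure_inter_subset hSo hSne ?_ hz).self_of_nhds
  rintro w ⟨hw, hwΩ⟩
  by_contra hwS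
  have hfw := hf w (coe_mem_outerSphereDomain.2 hwΩ)
  -- At a limit point `w` of the open set where `f` is locally `∞`, continuity forces `f w = ∞`.
  -- Then `1 / f` is analytic at `w` with accumulating zeros, so it vanishes identically near `w`.
  have hfr : ∃ᶠ y : ℂ in 𝓝[≠] w, f y = ∞ := by
    rw [frequently_nhdsWithin_iff]
    refine (mem_closure_iff_frequently.1 hw).mono fun y hy => ⟨hy.self_of_nhds, ?_⟩
    rintro rfl
    exact hwS hy
  have hwinf : f w = ∞ := by
    by_contra hne
    have h1 := hfw.continuousAt_coe.eventually (isOpen_compl_singleton.mem_nhds hne)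
    exact hfr ((h1.filter_mono nhdsWithin_le_nhds).mono fun y hy => hy)
  have h2 := (hfw.analyticAt_inv_affineCoord hwinf).frequently_zero_iff_eventually_zero.1
    (hfr.mono fun y hy => by rw [inv_eq_zero, affineCoord_eq_zero_iff]; exact Or.inl hy)
  have h3 := hfw.continuousAt_coe.tendsto
  rw [hwinf] at h3
  exact hwS (eventually_eq_infty_of_inv_eq_zero h3 h2)

/-- In the coordinate `w = 1 / z`, the function `1 / f` is analytic and vanishes at `0`, but not
identically, by the identity theorem. So it equals `w ^ n * g w` with `n ≥ 1` and `g 0 ≠ 0`, and `A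
= 1 / g 0`. -/
theorem exists_hasLeadingTermAtInfinity (hK : IsCompact K)
    (hf : ∀ p ∈ outerSphereDomain K, SphereHolomorphicAt f p)
    (hnc : ¬ ∃ c, ∀ p ∈ outerSphereDomain K, f p = c) (hinf : f ∞ = ∞) :
    ∃ (A : ℂ) (n : ℕ), HasLeadingTermAtInfinity f A n := by
  obtain ⟨hcont, hana⟩ := hf ∞ infty_mem_outerSphereDomain
  rw [ContinuousAt, hinf] at hcont
  rw [hinf, sphereCoord_infty] at hana
  simp_rw [sphereCoord_infty] at hana
  have h0 : (affineCoord ∞ : ℂ)⁻¹ = 0 := by simp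
  rw [h0] at hana
  set F : ℂ → ℂ := fun w => (affineCoord (f (sphereParam ∞ w)))⁻¹ with hF
  have hpar : ∀ w : ℂ, w ≠ 0 → sphereParam ∞ w = ((w⁻¹ : ℂ) : OnePoint ℂ) := fun w hw => by
    exact if_neg hw
  have hF0 : F 0 = 0 := by
    have : sphereParam ∞ 0 = ∞ := if_pos rfl
    simp only [hF, this, hinf, h0]
  have hz0 : ∀ᶠ z in Bornology.cobounded ℂ, z ≠ (0 : ℂ) := by
    filter_upwards [tendsto_norm_cobounded_atTop.eventually_gt_atTop 0] with z hz
      using norm_pos_iff.1 hz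
  have hinv : Tendsto (fun z : ℂ => z⁻¹) (Bornology.cobounded ℂ) (𝓝 0) := tendsto_inv₀_cobounded
  have hFφ : ∀ z : ℂ, z ≠ 0 → F z⁻¹ = (affineCoord (f z))⁻¹ := fun z hz => by
    simp only [hF, hpar _ (inv_ne_zero hz), inv_inv]
  have hnz : ¬ ∀ᶠ w in 𝓝 (0 : ℂ), F w = 0 := by
    intro h
    have h1 : ∀ᶠ z : ℂ in Bornology.cobounded ℂ, f z = ∞ := by
      refine eventually_eq_infty_of_inv_eq_zero (hcont.comp tendsto_coe_cobounded_infty) ?_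
      filter_upwards [hinv.eventually h, hz0] with z hz hz0
      rw [← hFφ z hz0]; exact hz
    refine hnc ⟨∞, fun p hp => ?_⟩
    rcases hp with rfl | ⟨z, hz, rfl⟩
    · exact hinf
    · exact eq_infty_of_eventually_eq_infty hK hf h1 hz
  obtain ⟨n, g, hg, hg0, hFg⟩ := hana.exists_eventuallyEq_pow_smul_nonzero_iff.2 hnz
  simp only [sub_zero, smul_eq_mul] at hFg
  have hn : 1 ≤ n := by
    rw [Nat.one_le_iff_ne_zero]
    rintro rfl
    have := hFg.self_of_nhds
    rw [hF0, pow_zero, one_mul] at this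
    exact hg0 this.symm
  refine ⟨(g 0)⁻¹, n, inv_ne_zero hg0, hn, ?_⟩
  rw [Asymptotics.isEquivalent_iff_tendsto_one (hz0.mono fun z hz =>
      mul_ne_zero (inv_ne_zero hg0) (pow_ne_zero _ hz))]
  have h1 : Tendsto (fun z : ℂ => g 0 / g z⁻¹) (Bornology.cobounded ℂ) (𝓝 1) := by
    have := (tendsto_const_nhds (x := g 0)).div (hg.continuousAt.tendsto.comp hinv) hg0
    rwa [div_self hg0] at this
  refine h1.congr' ?_
  filter_upwards [hinv.eventually hFg, hz0] with z hz hz0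
  rw [hFφ z hz0, inv_eq_iff_eq_inv] at hz
  rw [Pi.div_apply, hz, inv_pow, mul_inv, inv_inv]
  field_simp

end

/-! ### Capacity inequality and equality for maps of outer domains -/

section

variable {K₁ K₂ : Set ℂ} {f : OnePoint ℂ → OnePoint ℂ}

lemma affineCoord_mem_outerDomain (hmaps : Set.MapsTo f (outerSphereDomain K₁) (outerSphereDomain K₂))
    {z : ℂ} (hz : z ∈ outerDomain K₁) (hfz : f z ≠ ∞) : affineCoord (f z) ∈ outerDomain K₂ := by
  have := hmaps (coe_mem_outerSphereDomain.2 hz)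
  rwa [← coe_affineCoord hfz, coe_mem_outerSphereDomain] at this

/-- The general inequality is applied on `Ω_{K₁}` with the finite poles removed; the new frontier
points are exactly the kind where `f` tends to infinity. -/
theorem logCapacity_le_of_hasLeadingTermAtInfinity (hK₁ : IsCompact K₁) (hK₂ : IsCompact K₂)
    (hne₁ : K₁.Nonempty) (hne₂ : K₂.Nonempty)
    (hf : ∀ p ∈ outerSphereDomain K₁, SphereHolomorphicAt f p)
    (hmaps : Set.MapsTo f (outerSphereDomain K₁) (outerSphereDomain K₂)) {A : ℂ} {n : ℕ}
    (h : HasLeadingTermAtInfinity f A n) : logCapacity K₂ ≤ ‖A‖ * logCapacity K₁ ^ n := by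
  obtain ⟨hA, hn, hequiv⟩ := h
  have hΩ := isOpen_outerDomain hK₁
  have hf' : ∀ z ∈ outerDomain K₁, SphereHolomorphicAt f z := fun z hz =>
    hf z (coe_mem_outerSphereDomain.2 hz)
  set W : Set ℂ := {z | z ∈ outerDomain K₁ ∧ f z ≠ ∞} with hW
  have hWo : IsOpen W := isOpen_iff_mem_nhds.2 fun z hz => inter_mem (hΩ.mem_nhds hz.1)
    ((hf' z hz.1).continuousAt_coe.eventually (isOpen_compl_singleton.mem_nhds hz.2))
  have hWinf : W ∈ Bornology.cobounded ℂ := by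
    have h1 := (tendsto_cobounded_of_isEquivalent hA hn hequiv).1
    filter_upwards [outerDomain_mem_cobounded hK₁,
      (tendsto_norm_cobounded_atTop.comp h1).eventually_gt_atTop 0] with z hz hz0
    refine ⟨hz, fun hinf => ?_⟩
    simp [hinf] at hz0
  refine logCapacity_le_of_isEquivalent hK₁ hne₁ hK₂ hne₂ hWo hWinf
    (fun z hz => outerDomain_subset_compl hz.1)
    (fun z hz => (hf' z hz.1).analyticAt_affineCoord hz.2)
    (fun z hz => outerDomain_subset_compl (affineCoord_mem_outerDomain hmaps hz.1 hz.2))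
    (fun ζ hζ => ?_) hA hn hequiv
  by_cases hζΩ : ζ ∈ outerDomain K₁
  · right
    have hζinf : f ζ = ∞ := by
      by_contra hne
      exact hζ.2 (hWo.interior_eq.symm ▸ (⟨hζΩ, hne⟩ : ζ ∈ W))
    refine tendsto_cobounded_of_tendsto_infty (eventually_mem_nhdsWithin.mono fun z (hz : z ∈ W) => hz.2) ?_
    have := (hf' ζ hζΩ).continuousAt_coe.tendsto
    rw [hζinf] at this
    exact this.mono_left nhdsWithin_le_nhds
  · left
    refine frontier_outerDomain_subset hK₁ ⟨closure_mono (fun z hz => hz.1) hζ.1, ?_⟩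
    rwa [hΩ.interior_eq]

/-- Without finite poles the affine coordinate of `f` stays inside `Ω_{K₂}`, so the limit holds
within that domain, as composition with the boundary limits of the Green's function requires. -/
lemma tendsto_affineCoord_of_extendsToBoundary
    (hmaps : Set.MapsTo f (outerSphereDomain K₁) (outerSphereDomain K₂))
    (hpole : ∀ p ∈ outerSphereDomain K₁, f p = ∞ → p = ∞) (hext : ExtendsToBoundary K₁ K₂ f)
    {ζ : ℂ} (hζ : ζ ∈ frontier (outerDomain K₁)) :
    ∃ ω ∈ frontier (outerDomain K₂), Tendsto (fun z : ℂ => affineCoord (f z))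
      (𝓝[outerDomain K₁] ζ) (𝓝[outerDomain K₂] ω) := by
  obtain ⟨F, hFf, hFc, hF⟩ := hext
  obtain ⟨ω, hω, hFω⟩ := hF ζ hζ
  have hfin : ∀ z ∈ outerDomain K₁, f z ≠ ∞ := fun z hz h =>
    OnePoint.coe_ne_infty z (hpole _ (coe_mem_outerSphereDomain.2 hz) h)
  refine ⟨ω, hω, tendsto_nhdsWithin_iff.2 ⟨?_, eventually_mem_nhdsWithin.mono fun z hz =>
    affineCoord_mem_outerDomain hmaps hz (hfin z hz)⟩⟩
  have h1 : Tendsto (fun z : ℂ => (z : OnePoint ℂ)) (𝓝[outerDomain K₁] ζ)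
      (𝓝[outerSphereDomain K₁ ∪ (fun z : ℂ => (z : OnePoint ℂ)) '' frontier (outerDomain K₁)]
        (ζ : OnePoint ℂ)) :=
    tendsto_nhdsWithin_iff.2 ⟨OnePoint.continuous_coe.continuousAt.tendsto.mono_left
      nhdsWithin_le_nhds, eventually_mem_nhdsWithin.mono fun z hz =>
        Or.inl (coe_mem_outerSphereDomain.2 hz)⟩
  have h2 := (hFc ζ (Or.inr ⟨ζ, hζ, rfl⟩)).tendsto.comp h1
  rw [hFω] at h2
  rw [OnePoint.isOpenEmbedding_coe.tendsto_nhds_iff]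
  refine h2.congr' (eventually_mem_nhdsWithin.mono fun z hz => ?_)
  simp only [Function.comp_apply]
  rw [hFf (coe_mem_outerSphereDomain.2 hz), coe_affineCoord (hfin z hz)]

/-- The pullback `g = g₂(f) / n` vanishes on the boundary, and the inequality from (a) supplies `V₁
≤ b` for its constant `b` at infinity. These are the hypotheses of `eq_sub_realLogPotential`, which
identifies `g` with `V₁ - U^{μ₁}`; all four conclusions are read off from this identity and from `b
= V₁`. -/
theorem regular_and_greenFunction_of_extendsToBoundary (hK₁ : IsCompact K₁) (hK₂ : IsCompact K₂)
    (hne₁ : K₁.Nonempty) (hne₂ : K₂.Nonempty)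
    (hf : ∀ p ∈ outerSphereDomain K₁, SphereHolomorphicAt f p)
    (hmaps : Set.MapsTo f (outerSphereDomain K₁) (outerSphereDomain K₂)) {A : ℂ} {n : ℕ}
    (h : HasLeadingTermAtInfinity f A n) (hcap : 0 < logCapacity K₂)
    (hpole : ∀ p ∈ outerSphereDomain K₁, f p = ∞ → p = ∞) (hreg : IsRegularOuterDomain K₂)
    (hext : ExtendsToBoundary K₁ K₂ f) :
    0 < logCapacity K₁ ∧ IsRegularOuterDomain K₁ ∧
      (∀ z ∈ outerDomain K₁, greenFunction K₁ z =
        (1 / (n : ℝ)) * greenFunction K₂ (affineCoord (f (z : OnePoint ℂ)))) ∧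
      ‖A‖ * logCapacity K₁ ^ n = logCapacity K₂ := by
  obtain ⟨hA, hn, hequiv⟩ := h
  have hn' : (0 : ℝ) < n := by exact_mod_cast hn
  obtain ⟨V₂, hV₂⟩ := exists_robinConstant_eq hK₂ hcap
  have hΩ := isOpen_outerDomain hK₁
  have hfin : ∀ z ∈ outerDomain K₁, f z ≠ ∞ := fun z hz h =>
    OnePoint.coe_ne_infty z (hpole _ (coe_mem_outerSphereDomain.2 hz) h)
  have hφ : AnalyticOnNhd ℂ (fun z : ℂ => affineCoord (f z)) (outerDomain K₁) := fun z hz =>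
    (hf z (coe_mem_outerSphereDomain.2 hz)).analyticAt_affineCoord (hfin z hz)
  have hφmaps : Set.MapsTo (fun z : ℂ => affineCoord (f z)) (outerDomain K₁) (outerDomain K₂) :=
    fun z hz => affineCoord_mem_outerDomain hmaps hz (hfin z hz)
  obtain ⟨V₁, hV₁, hle⟩ := robinConstant_le_of_isEquivalent hK₁ hne₁ hK₂ hne₂ hΩ
    (outerDomain_mem_cobounded hK₁) outerDomain_subset_compl hφ
    (hφmaps.mono_right outerDomain_subset_compl)
    (fun ζ hζ => Or.inl (frontier_outerDomain_subset hK₁ hζ)) hA hn hequiv hV₂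
  have hμ₁ := isEquilibriumMeasure_equilibriumMeasure hK₁ hne₁
  have hμ₂ := isEquilibriumMeasure_equilibriumMeasure hK₂ hne₂
  set μ₁ := equilibriumMeasure K₁ with hμ₁def
  set μ₂ := equilibriumMeasure K₂ with hμ₂def
  have hreg₂ := (isRegularOuterDomain_iff hK₂ hne₂ hV₂).1 hreg
  set g : ℂ → ℝ := fun z => 1 / (n : ℝ) * (V₂ - realLogPotential μ₂ (affineCoord (f z))) with hg
  have hg0 : ∀ ζ ∈ frontier (outerDomain K₁), Tendsto g (𝓝[outerDomain K₁] ζ) (𝓝 0) := by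
    intro ζ hζ
    obtain ⟨ω, hω, hlim⟩ := tendsto_affineCoord_of_extendsToBoundary hmaps hpole hext hζ
    have := ((hreg₂ ω hω).comp hlim).const_mul (1 / (n : ℝ))
    rwa [mul_zero] at this
  have hgharm : InnerProductSpace.HarmonicOnNhd g (outerDomain K₁) := fun z hz =>
    ((harmonicOnNhd_sub_realLogPotential hK₂ hμ₂.1 V₂ _
      (outerDomain_subset_compl (hφmaps hz))).comp_analyticAt (hφ z hz)).const_mul _
  obtain ⟨hb, heq⟩ := eq_sub_realLogPotential hK₁ hμ₁ hV₁ hgharm hg0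
    (tendsto_comp_sub_log (tendsto_sub_realLogPotential_sub_log hK₂ hμ₂.1 V₂) hA hn hequiv) hle
  have hreg₁ : ∀ ζ ∈ frontier (outerDomain K₁),
      Tendsto (fun z => V₁ - realLogPotential μ₁ z) (𝓝[outerDomain K₁] ζ) (𝓝 0) := fun ζ hζ =>
    (hg0 ζ hζ).congr' (eventually_mem_nhdsWithin.mono fun z hz => (heq z hz).symm)
  refine ⟨?_, (isRegularOuterDomain_iff hK₁ hne₁ hV₁).2 hreg₁, fun z hz => ?_, ?_⟩
  · rw [logCapacity_of_robinConstant_eq hV₁]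
    exact Real.exp_pos _
  · rw [greenFunction_eq_sub_realLogPotential hK₁ hne₁ hμ₁ hV₁ hreg₁ hz,
      greenFunction_eq_sub_realLogPotential hK₂ hne₂ hμ₂ hV₂ hreg₂ (hφmaps hz)]
    exact heq z hz
  · rw [logCapacity_of_robinConstant_eq hV₁, logCapacity_of_robinConstant_eq hV₂,
      norm_mul_exp_neg_pow hA, ← hb]
    congr 1
    field_simp
    ring

end

end

theorem theorem2 :
    (∀ (K₁ K₂ : Set ℂ), IsCompact K₁ → IsCompact K₂ → K₁.Nonempty → K₂.Nonempty →
      ∀ f : OnePoint ℂ → OnePoint ℂ,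
        (∀ p ∈ outerSphereDomain K₁, SphereHolomorphicAt f p) →
        Set.MapsTo f (outerSphereDomain K₁) (outerSphereDomain K₂) →
        (¬ ∃ c, ∀ p ∈ outerSphereDomain K₁, f p = c) →
        f ∞ = ∞ →
        (∃ (A : ℂ) (n : ℕ), HasLeadingTermAtInfinity f A n) ∧
        ∀ (A : ℂ) (n : ℕ), HasLeadingTermAtInfinity f A n →
          logCapacity K₂ ≤ ‖A‖ * logCapacity K₁ ^ n ∧
          (0 < logCapacity K₂ →
            (∀ p ∈ outerSphereDomain K₁, f p = ∞ → p = ∞) →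
            IsRegularOuterDomain K₂ →
            ExtendsToBoundary K₁ K₂ f →
            0 < logCapacity K₁ ∧
            IsRegularOuterDomain K₁ ∧
            (∀ z ∈ outerDomain K₁,
              greenFunction K₁ z =
                (1 / (n : ℝ)) * greenFunction K₂ (affineCoord (f (z : OnePoint ℂ)))) ∧
            ‖A‖ * logCapacity K₁ ^ n = logCapacity K₂)) ∧
    (∀ (P : Polynomial ℂ), 1 ≤ P.natDegree → ∀ K : Set ℂ, IsCompact K →
      ‖P.leadingCoeff‖ * logCapacity ((fun z => P.eval z) ⁻¹' K) ^ P.natDegree =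
        logCapacity K) := by
  refine ⟨fun K₁ K₂ hK₁ hK₂ hne₁ hne₂ f hf hmaps hnc hinf =>
    ⟨exists_hasLeadingTermAtInfinity hK₁ hf hnc hinf, fun A n h =>
      ⟨logCapacity_le_of_hasLeadingTermAtInfinity hK₁ hK₂ hne₁ hne₂ hf hmaps h,
        fun hcap hpole hreg hext => regular_and_greenFunction_of_extendsToBoundary hK₁ hK₂ hne₁
          hne₂ hf hmaps h hcap hpole hreg hext⟩⟩,
    fun P hP K hK => logCapacity_preimage_eval hP hK⟩
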